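/- Let $\Delta_2 f(x,h)=\dfrac{f(x+h)-2f(x)+f(x-h)}{h}$ for $f:\mathbb R\to\mathbb R$, $x\in\mathbb R$, $h>0$, and let $\|f\|_*=\sup_{x\in\mathbb R,\,h>0}|\Delta_2 f(x,h)|$. The Zygmund class $\Lambda_*$ is the set of continuous $f:\mathbb R\to\mathbb R$ with $\|f\|_*<\infty$. Let $\mathrm{BMO}$ be the set of locally integrable $u:\mathbb R\to\mathbb R$ with $\sup_I\big(\frac1{|I|}\int_I|u-u_I|^2\,dx\big)^{1/2}<\infty$, where $I$ ranges over all bounded nondegenerate intervals and $u_I=\frac1{|I|}\int_I u\,dx$, and let $\mathrm I(\mathrm{BMO})\subset\Lambda_*$ be the set of continuous $f:\mathbb R\to\mathbb R$ whose distributional derivative belongs to $\mathrm{BMO}$. Let $\overline{\mathrm I(\mathrm{BMO})}$ be the closure of $\mathrm I(\mathrm{BMO})$ in $\Lambda_*$ with respect to the pseudometric $\operatorname{dist}(f,g)=\|f-g\|_*$. For $\varepsilon>0$ put $A(f,\varepsilon)=\{(x,h): x\in\mathbb R,\ h>0,\ |\Delta_2 f(x,h)|>\varepsilon\}$. **Corollary.**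 Let $f\in\Lambda_*$ be compactly supported. Then $f\in\overline{\mathrm I(\mathrm{BMO})}$ if and only if for every $\varepsilon>0$ there exists a constant $C(\varepsilon)>0$ such that $$\frac1{|I|}\int_I\int_0^{|I|}\chi_{A(f,\varepsilon)}(x,h)\,\frac{dh\,dx}{h}\le C(\varepsilon)$$ for every bounded nondegenerate interval $I\subset\mathbb R$. -/

import Mathlib

open Set MeasureTheory
open scoped ENNReal ContDiff

noncomputable section

/-- The second divided difference `Δ₂f(x,h) = (f(x+h) - 2f(x) + f(x-h)) / h`
(only used for `h > 0`). -/
def secondDividedDiff (f : ℝ → ℝ) (x h : ℝ) : ℝ :=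
  (f (x + h) - 2 * f x + f (x - h)) / h

/-- The Zygmund seminorm `‖f‖_* = sup_{x ∈ ℝ, h > 0} |Δ₂f(x,h)|`, with values in `[0,∞]`. -/
def zygmundSeminorm (f : ℝ → ℝ) : ℝ≥0∞ :=
  ⨆ (x : ℝ) (h : ℝ) (_ : 0 < h), ENNReal.ofReal |secondDividedDiff f x h|

/-- The Zygmund class `Λ_*`: continuous real functions on the line with finite Zygmund seminorm. -/
def zygmundClass : Set (ℝ → ℝ) :=
  {f | Continuous f ∧ zygmundSeminorm f < ⊤}

/-- The (quadratic) BMO norm, with values in `[0,∞]`; the supremum is over all nondegenerate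
bounded intervals, and `⨍ y in Icc a b, u y` is the average of `u` on the interval. -/
def bmoNorm (u : ℝ → ℝ) : ℝ≥0∞ :=
  ⨆ (a : ℝ) (b : ℝ) (_ : a < b),
    ((∫⁻ x in Icc a b, ENNReal.ofReal (|u x - ⨍ y in Icc a b, u y| ^ 2)) /
      ENNReal.ofReal (b - a)) ^ (1 / 2 : ℝ)

/-- Functions of bounded mean oscillation. -/
def BMO : Set (ℝ → ℝ) :=
  {u | LocallyIntegrable u volume ∧ bmoNorm u < ⊤}

/-- `u` is the derivative of `f` in the sense of distributions (for locally integrable `f`, `u`). -/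
def HasDistribDeriv (f u : ℝ → ℝ) : Prop :=
  ∀ φ : ℝ → ℝ, ContDiff ℝ ∞ φ → HasCompactSupport φ →
    ∫ x, f x * deriv φ x = -∫ x, u x * φ x

/-- `I(BMO)`: continuous functions whose distributional derivative is a BMO function. -/
def IBMO : Set (ℝ → ℝ) :=
  {f | Continuous f ∧ ∃ u ∈ BMO, HasDistribDeriv f u}

/-- The closure of `S` in `Λ_*` for the pseudometric `dist(f,g) = ‖f - g‖_*`. -/
def zygmundClosure (S : Set (ℝ → ℝ)) : Set (ℝ → ℝ) :=
  {f | f ∈ zygmundClass ∧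
    ∀ ε : ℝ, 0 < ε → ∃ g ∈ S ∩ zygmundClass, zygmundSeminorm (f - g) < ENNReal.ofReal ε}

/-- `A(f,ε) = {(x,h) : h > 0, |Δ₂f(x,h)| > ε}`, a subset of the upper half plane. -/
def zygmundLargeSet (f : ℝ → ℝ) (ε : ℝ) : Set (ℝ × ℝ) :=
  {p | 0 < p.2 ∧ ε < |secondDividedDiff f p.1 p.2|}

/-- `|I|⁻¹ ∫_I ∫_0^{|I|} χ_{A(f,ε)}(x,h) dh dx / h` for `I = [a,b]`, with values in `[0,∞]`. -/
def zygmundDensity (f : ℝ → ℝ) (ε a b : ℝ) : ℝ≥0∞ :=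
  (∫⁻ x in Icc a b, ∫⁻ h in Ioc 0 (b - a),
    (zygmundLargeSet f ε).indicator (fun _ => (1 : ℝ≥0∞)) (x, h) / ENNReal.ofReal h) /
      ENNReal.ofReal (b - a)

end

/-! Both directions rest on an `L²` estimate for second divided differences, where `V` is the
primitive of `v ∈ L²`: the integral of `|Δ₂V|²` against `dx dh / h` is at most `4‖v‖²`
(`lintegral_sq_secondDividedDiff_primitive_le`). By the parallelogram law, `N(h) = ‖Δ₂V(·,h)‖²`
equals `4M(h) - 4M(2h)`, where `M(h)` is the squared norm of the forward quotient of step `h`. Since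
`dh/h` is invariant under `h ↦ 2h`, the integral of `N` telescopes.

Necessity. If `g' = u ∈ BMO`, then on the box over `I` only the values of `g` on the triple of `I`
matter, and affine functions are invisible to `Δ₂`. So `u` may be replaced there by its oscillation,
and the `L²` estimate makes `|Δ₂g|² dx dh / h` a Carleson measure. If `‖f - g‖_* < ε/2`, then `|Δ₂g|
> ε/2` on `A(f,ε)`, and Chebyshev's inequality gives the density bound.

Sufficiency. Let `T_h` be averaging against a triangular kernel of width `h`. Then `T_h f - T_{2h} f
= -(h/4) T_h(Δ₂f(·,h))`, and integrating against `dh/h` gives `log 2 · f = ∫_H^{2H} T_h f dh/h -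
(1/4) ∫_0^H T_h(Δ₂f(·,h)) dh` (`log_two_mul_eq`). The first term has Zygmund seminorm `O(‖f‖_∞/H)`.
The coefficients `Δ₂f` are split according to `A(f,ε)`. Superposition is bounded from `L^∞`
coefficients to `Λ_*`, so the part off the set has seminorm `O(ε)`. The part on the set is the
approximant: its coefficients are bounded and carried by a Carleson set, and it lies in `I(BMO)` by
duality (`tentSynthesis_mem_IBMO`). Indeed, tested against `φ'`, it gives the pairing of its
coefficients with `Δ₂(∫φ)`. The `L²` estimate and the Riesz theorem turn this pairing into a
function `u`, and estimates on atoms put `u` in `BMO`. -/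

/-! ### The scale-invariant half-plane measure and primitives -/

/-- The measure `dh / h` on the half line `h > 0`. -/
noncomputable def scaleMeasure : Measure ℝ :=
  (volume.restrict (Ioi 0)).withDensity fun h => (ENNReal.ofReal h)⁻¹

instance : SFinite scaleMeasure := by unfold scaleMeasure; infer_instance

/-- The measure `dx dh / h` on the upper half plane. -/
noncomputable def halfPlaneMeasure : Measure (ℝ × ℝ) := volume.prod scaleMeasure

instance : SFinite halfPlaneMeasure := by unfold halfPlaneMeasure; infer_instance

/-- The primitive of `v` that vanishes at the origin. -/
noncomputable def primitive (v : ℝ → ℝ) (x : ℝ) : ℝ := ∫ t in (0 : ℝ)..x, v t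

theorem lintegral_scaleMeasure {F : ℝ → ℝ≥0∞} (hF : Measurable F) :
    ∫⁻ h, F h ∂scaleMeasure = ∫⁻ h in Ioi 0, (ENNReal.ofReal h)⁻¹ * F h := by
  unfold scaleMeasure
  rw [lintegral_withDensity_eq_lintegral_mul _ (by fun_prop) hF]
  rfl

theorem setLIntegral_scaleMeasure {F : ℝ → ℝ≥0∞} (hF : Measurable F) {s : Set ℝ}
    (hs : MeasurableSet s) (hs0 : s ⊆ Ioi 0) :
    ∫⁻ h in s, F h ∂scaleMeasure = ∫⁻ h in s, (ENNReal.ofReal h)⁻¹ * F h := by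
  unfold scaleMeasure
  rw [setLIntegral_withDensity_eq_setLIntegral_mul _ (by fun_prop) hF hs,
    Measure.restrict_restrict hs, inter_eq_left.2 hs0]
  rfl

theorem lintegral_halfPlaneMeasure {F : ℝ × ℝ → ℝ≥0∞} (hF : Measurable F) :
    ∫⁻ p, F p ∂halfPlaneMeasure = ∫⁻ h in Ioi 0, (ENNReal.ofReal h)⁻¹ * ∫⁻ x, F (x, h) := by
  unfold halfPlaneMeasure
  rw [lintegral_prod_symm _ hF.aemeasurable, lintegral_scaleMeasure hF.lintegral_prod_left']

theorem primitive_sub {v : ℝ → ℝ} (hv : LocallyIntegrable v) (x y : ℝ) :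
    primitive v y - primitive v x = ∫ t in x..y, v t :=
  intervalIntegral.integral_interval_sub_left
    (hv.integrableOn_isCompact isCompact_uIcc).intervalIntegrable
    (hv.integrableOn_isCompact isCompact_uIcc).intervalIntegrable

theorem continuous_primitive {v : ℝ → ℝ} (hv : LocallyIntegrable v) :
    Continuous (primitive v) :=
  intervalIntegral.continuous_primitive
    (fun _ _ => (hv.integrableOn_isCompact isCompact_uIcc).intervalIntegrable) 0

theorem measurable_secondDividedDiff {f : ℝ → ℝ} (hf : Continuous f) :
    Measurable fun p : ℝ × ℝ => secondDividedDiff f p.1 p.2 := by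
  unfold secondDividedDiff
  have := hf.measurable
  fun_prop

theorem enorm_sq_eq_ofReal (x : ℝ) : ‖x‖ₑ ^ 2 = ENNReal.ofReal (x ^ 2) := by
  rw [← ofReal_norm, ← ENNReal.ofReal_pow (norm_nonneg _), Real.norm_eq_abs, sq_abs]

theorem sq_lintegral_le_measure_mul {α : Type*} [MeasurableSpace α] {μ : Measure α}
    {F : α → ℝ≥0∞} (hF : AEMeasurable F μ) :
    (∫⁻ x, F x ∂μ) ^ 2 ≤ μ univ * ∫⁻ x, F x ^ 2 ∂μ := by
  have h := ENNReal.lintegral_mul_le_Lp_mul_Lq μ Real.HolderConjugate.two_two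
    (aemeasurable_const (b := (1 : ℝ≥0∞))) hF
  simp only [Pi.mul_apply, one_mul, ENNReal.one_rpow, lintegral_const] at h
  calc (∫⁻ x, F x ∂μ) ^ 2 ≤ _ := pow_le_pow_left' h 2
    _ = _ := by
      rw [mul_pow, ← ENNReal.rpow_natCast, ← ENNReal.rpow_mul, ← ENNReal.rpow_natCast,
        ← ENNReal.rpow_mul]
      norm_num

theorem enorm_intervalIntegral_le (v : ℝ → ℝ) {a b : ℝ} (hab : a ≤ b) :
    ‖∫ t in a..b, v t‖ₑ ≤ ∫⁻ t in Ioc a b, ‖v t‖ₑ := by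
  rw [intervalIntegral.integral_of_le hab]
  exact enorm_integral_le_lintegral_enorm _

theorem setLIntegral_Ioc_add (F : ℝ → ℝ≥0∞) (y h : ℝ) :
    ∫⁻ t in Ioc y (y + h), F t = ∫⁻ s in Ioc 0 h, F (y + s) := by
  rw [add_comm y h]
  have h1 := (measurePreserving_add_left volume y).setLIntegral_comp_emb
    (measurableEmbedding_addLeft y) F (Ioc 0 h)
  simpa using h1.symm

/-! ### The `L²` square function estimate -/

/-- The average of `v` over the intervals `[y, y + h]` is an `L²` contraction. -/
theorem lintegral_sq_average_le {v : ℝ → ℝ} (hv : MemLp v 2) {h : ℝ} (hh : 0 < h) :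
    ∫⁻ y, ‖(primitive v (y + h) - primitive v y) / h‖ₑ ^ 2 ≤ ∫⁻ t, ‖v t‖ₑ ^ 2 := by
  have hloc : LocallyIntegrable v := hv.locallyIntegrable (by norm_num)
  set w := hv.1.mk v with hw
  have hvw : v =ᵐ[volume] w := hv.1.ae_eq_mk
  have hwm : Measurable w := hv.1.stronglyMeasurable_mk.measurable
  have key : ∀ y, ‖primitive v (y + h) - primitive v y‖ₑ ^ 2 ≤
      ENNReal.ofReal h * ∫⁻ s in Ioc 0 h, ‖w (y + s)‖ₑ ^ 2 := by
    intro y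
    have hc : ∫ t in y..(y + h), v t = ∫ t in y..(y + h), w t :=
      intervalIntegral.integral_congr_ae (hvw.mono fun t ht _ => ht)
    rw [primitive_sub hloc, hc]
    refine (pow_le_pow_left' (enorm_intervalIntegral_le w (by linarith)) 2).trans ?_
    refine (sq_lintegral_le_measure_mul (by fun_prop)).trans ?_
    rw [← setLIntegral_Ioc_add (fun t => ‖w t‖ₑ ^ 2)]
    simp
  have hne : ENNReal.ofReal h ≠ 0 := by simpa using hh
  calc ∫⁻ y, ‖(primitive v (y + h) - primitive v y) / h‖ₑ ^ 2
      ≤ ∫⁻ y, (ENNReal.ofReal h)⁻¹ * ∫⁻ s in Ioc 0 h, ‖w (y + s)‖ₑ ^ 2 := by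
        refine lintegral_mono fun y => ?_
        have e : ‖(primitive v (y + h) - primitive v y) / h‖ₑ ^ 2 =
            ((ENNReal.ofReal h)⁻¹ * (ENNReal.ofReal h)⁻¹) *
              ‖primitive v (y + h) - primitive v y‖ₑ ^ 2 := by
          rw [div_eq_mul_inv, enorm_mul, mul_pow, mul_comm, Real.enorm_of_nonneg (by positivity),
            ENNReal.ofReal_inv_of_pos hh, sq]
        rw [e]
        refine (mul_le_mul_right (key y) _).trans_eq ?_
        rw [← mul_assoc, mul_assoc (ENNReal.ofReal h)⁻¹,
          ENNReal.inv_mul_cancel hne ENNReal.ofReal_ne_top, mul_one]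
    _ = (ENNReal.ofReal h)⁻¹ * ∫⁻ s in Ioc 0 h, ∫⁻ y, ‖w (y + s)‖ₑ ^ 2 := by
        rw [lintegral_const_mul' _ _ (by simpa using hh), lintegral_lintegral_swap]
        exact Measurable.aemeasurable (by fun_prop)
    _ = (ENNReal.ofReal h)⁻¹ * ∫⁻ s in Ioc 0 h, ∫⁻ y, ‖w y‖ₑ ^ 2 := by
        congr 1
        exact lintegral_congr fun s => lintegral_add_right_eq_self (fun y => ‖w y‖ₑ ^ 2) s
    _ = ∫⁻ y, ‖w y‖ₑ ^ 2 := by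
        simp only [lintegral_const, Measure.restrict_apply, MeasurableSet.univ, univ_inter,
          Real.volume_Ioc, sub_zero]
        rw [mul_comm, mul_assoc, ENNReal.mul_inv_cancel hne ENNReal.ofReal_ne_top, mul_one]
    _ = _ := lintegral_congr_ae (hvw.mono fun t ht => by simp [ht])

/-- Parallelogram law for the forward and backward quotients at `y`: half their sum is the symmetric
quotient of step `2h`, and their difference is `Δ₂V`. Translation invariance makes the two quotients
equal in norm. -/
theorem lintegral_sq_average_eq {V : ℝ → ℝ} (hV : Continuous V) {h : ℝ} (hh : 0 < h) :
    4 * ∫⁻ y, ‖(V (y + h) - V y) / h‖ₑ ^ 2 =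
      4 * (∫⁻ y, ‖(V (y + 2 * h) - V y) / (2 * h)‖ₑ ^ 2) +
        ∫⁻ y, ‖secondDividedDiff V y h‖ₑ ^ 2 := by
  have hm : Measurable V := hV.measurable
  have e1 : ∫⁻ y, ‖(V y - V (y - h)) / h‖ₑ ^ 2 = ∫⁻ y, ‖(V (y + h) - V y) / h‖ₑ ^ 2 := by
    rw [← lintegral_add_right_eq_self _ h]
    simp
  have e2 : ∫⁻ y, ‖(V (y + h) - V (y - h)) / (2 * h)‖ₑ ^ 2 =
      ∫⁻ y, ‖(V (y + 2 * h) - V y) / (2 * h)‖ₑ ^ 2 := by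
    rw [← lintegral_add_right_eq_self _ h]
    simp [two_mul, add_assoc]
  calc 4 * ∫⁻ y, ‖(V (y + h) - V y) / h‖ₑ ^ 2
      = ∫⁻ y, (2 * ‖(V (y + h) - V y) / h‖ₑ ^ 2 + 2 * ‖(V y - V (y - h)) / h‖ₑ ^ 2) := by
        rw [lintegral_add_left (by fun_prop), lintegral_const_mul _ (by fun_prop),
          lintegral_const_mul _ (by fun_prop), e1]
        ring
    _ = ∫⁻ y, (4 * ‖(V (y + h) - V (y - h)) / (2 * h)‖ₑ ^ 2 + ‖secondDividedDiff V y h‖ₑ ^ 2) := by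
        refine lintegral_congr fun y => ?_
        simp only [enorm_sq_eq_ofReal]
        rw [show (4 : ℝ≥0∞) = ENNReal.ofReal 4 by simp, show (2 : ℝ≥0∞) = ENNReal.ofReal 2 by simp,
          ← ENNReal.ofReal_mul (by norm_num),
          ← ENNReal.ofReal_mul (by norm_num), ← ENNReal.ofReal_mul (by norm_num),
          ← ENNReal.ofReal_add (by positivity) (by positivity),
          ← ENNReal.ofReal_add (by positivity) (by positivity)]
        congr 1
        unfold secondDividedDiff
        field_simp
        ring
    _ = _ := by
        rw [lintegral_add_left (by fun_prop), lintegral_const_mul _ (by fun_prop), e2]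

theorem setLIntegral_inv_mul_comp_two_mul (M : ℝ → ℝ≥0∞) {δ H : ℝ} (hδ : 0 < δ) :
    ∫⁻ h in Ioc δ H, (ENNReal.ofReal h)⁻¹ * M (2 * h) =
      ∫⁻ h in Ioc (2 * δ) (2 * H), (ENNReal.ofReal h)⁻¹ * M h := by
  have himg : (fun x : ℝ => 2 * x) '' Ioc δ H = Ioc (2 * δ) (2 * H) :=
    image_mul_left_Ioc two_pos _ _
  rw [← himg, lintegral_image_eq_lintegral_abs_deriv_mul measurableSet_Ioc (f' := fun _ => 2)
    (fun x _ => by simpa using ((hasDerivAt_id x).const_mul 2).hasDerivWithinAt)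
    (fun x _ y _ hxy => by simpa using hxy)]
  refine setLIntegral_congr_fun measurableSet_Ioc fun h hh => ?_
  have h0 : 0 < h := hδ.trans hh.1
  simp only [abs_two]
  rw [ENNReal.ofReal_mul zero_le_two, ENNReal.mul_inv (by simp) (by simp), ← mul_assoc,
    ← mul_assoc, ENNReal.mul_inv_cancel (by simp) (by simp), one_mul]

/-- Square function estimate for the second divided differences of a primitive. -/
theorem lintegral_sq_secondDividedDiff_primitive_le {v : ℝ → ℝ} (hv : MemLp v 2) :
    ∫⁻ p, ‖secondDividedDiff (primitive v) p.1 p.2‖ₑ ^ 2 ∂halfPlaneMeasure ≤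
      4 * ∫⁻ t, ‖v t‖ₑ ^ 2 := by
  set V := primitive v with hVdef
  have hV : Continuous V := continuous_primitive (hv.locallyIntegrable (by norm_num))
  have hVm : Measurable V := hV.measurable
  set E := ∫⁻ t, ‖v t‖ₑ ^ 2 with hE
  have hEtop : E ≠ ⊤ := by
    have := hv.2
    rw [eLpNorm_lt_top_iff_lintegral_rpow_enorm_lt_top (by norm_num) (by norm_num)] at this
    simpa using this.ne
  set M : ℝ → ℝ≥0∞ := fun h => ∫⁻ y, ‖(V (y + h) - V y) / h‖ₑ ^ 2 with hM
  set N : ℝ → ℝ≥0∞ := fun h => ∫⁻ y, ‖secondDividedDiff V y h‖ₑ ^ 2 with hN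
  have hMm : Measurable M := by
    refine Measurable.lintegral_prod_right' (f := fun p : ℝ × ℝ => ‖(V (p.2 + p.1) - V p.2) / p.1‖ₑ ^ 2) ?_
    fun_prop
  have hNm : Measurable N := by
    refine Measurable.lintegral_prod_left'
      (f := fun p : ℝ × ℝ => ‖secondDividedDiff V p.1 p.2‖ₑ ^ 2) ?_
    exact (measurable_secondDividedDiff hV).enorm.pow_const 2
  have hME : ∀ h, 0 < h → M h ≤ E := fun h hh => lintegral_sq_average_le hv hh
  have hMN : ∀ h, 0 < h → 4 * M h = 4 * M (2 * h) + N h := fun h hh =>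
    lintegral_sq_average_eq hV hh
  have hbd : ∀ δ s, 0 < δ → ∫⁻ h in Ioc δ s, (ENNReal.ofReal h)⁻¹ * M h ≤
      (ENNReal.ofReal δ)⁻¹ * E * ENNReal.ofReal (s - δ) := by
    intro δ s hδ
    rw [← Real.volume_Ioc, ← setLIntegral_const]
    refine setLIntegral_mono measurable_const fun h hh => ?_
    exact mul_le_mul' (ENNReal.inv_le_inv.2 (ENNReal.ofReal_le_ofReal hh.1.le))
      (hME h (hδ.trans hh.1))
  -- Telescoping on `[δ, H]`: after the substitution `h ↦ 2h` only the integral of `M` over `[δ,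
  -- 2δ]` survives, and there `1/h ≤ 1/δ` bounds it by `E`.
  have htrunc : ∀ δ H, 0 < δ → δ ≤ H → ∫⁻ h in Ioc δ H, (ENNReal.ofReal h)⁻¹ * N h ≤ 4 * E := by
    intro δ H hδ hH
    have h1 : 4 * ∫⁻ h in Ioc δ H, (ENNReal.ofReal h)⁻¹ * M h =
        4 * (∫⁻ h in Ioc (2 * δ) (2 * H), (ENNReal.ofReal h)⁻¹ * M h) +
          ∫⁻ h in Ioc δ H, (ENNReal.ofReal h)⁻¹ * N h := by
      rw [← setLIntegral_inv_mul_comp_two_mul M hδ, ← lintegral_const_mul _ (by fun_prop),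
        ← lintegral_const_mul _ (by fun_prop), ← lintegral_add_left (by fun_prop)]
      refine setLIntegral_congr_fun measurableSet_Ioc fun h hh => ?_
      have := hMN h (hδ.trans hh.1)
      calc 4 * ((ENNReal.ofReal h)⁻¹ * M h) = (ENNReal.ofReal h)⁻¹ * (4 * M h) := by ring
        _ = _ := by rw [this]; ring
    have h2 : ∫⁻ h in Ioc δ H, (ENNReal.ofReal h)⁻¹ * M h ≤
        (∫⁻ h in Ioc δ (2 * δ), (ENNReal.ofReal h)⁻¹ * M h) +
          ∫⁻ h in Ioc (2 * δ) (2 * H), (ENNReal.ofReal h)⁻¹ * M h := by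
      refine le_trans (lintegral_mono_set ?_) (lintegral_union_le _ _ _)
      intro x hx
      by_cases hx2 : x ≤ 2 * δ
      · exact Or.inl ⟨hx.1, hx2⟩
      · exact Or.inr ⟨not_le.1 hx2, by linarith [hx.2]⟩
    have h3 : ∫⁻ h in Ioc δ (2 * δ), (ENNReal.ofReal h)⁻¹ * M h ≤ E := by
      refine (hbd δ (2 * δ) hδ).trans_eq ?_
      rw [show 2 * δ - δ = δ by ring, mul_comm, ← mul_assoc,
        ENNReal.mul_inv_cancel (by simpa using hδ) (by simp), one_mul]
    -- Truncation away from zero serves here: the integral to be cancelled must be finite.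
    have hfin : 4 * (∫⁻ h in Ioc (2 * δ) (2 * H), (ENNReal.ofReal h)⁻¹ * M h) ≠ ⊤ := by
      refine ENNReal.mul_ne_top (by simp) (ne_top_of_le_ne_top ?_ (hbd (2 * δ) (2 * H) (by positivity)))
      refine ENNReal.mul_ne_top (ENNReal.mul_ne_top ?_ hEtop) (by simp)
      simpa using hδ
    rw [← ENNReal.add_le_add_iff_left hfin, ← h1]
    calc _ ≤ 4 * ((∫⁻ h in Ioc δ (2 * δ), (ENNReal.ofReal h)⁻¹ * M h) +
          ∫⁻ h in Ioc (2 * δ) (2 * H), (ENNReal.ofReal h)⁻¹ * M h) := by gcongr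
      _ ≤ 4 * (E + ∫⁻ h in Ioc (2 * δ) (2 * H), (ENNReal.ofReal h)⁻¹ * M h) := by gcongr
      _ = _ := by ring
  rw [lintegral_halfPlaneMeasure ((measurable_secondDividedDiff hV).enorm.pow_const 2)]
  have hU : Ioi (0 : ℝ) = ⋃ n : ℕ, Ioc (1 / ((n : ℝ) + 1)) (n + 1) := by
    ext x
    simp only [mem_Ioi, mem_iUnion, mem_Ioc]
    constructor
    · intro hx
      obtain ⟨n, hn⟩ := exists_nat_gt (max x (1 / x))
      have h1 := (le_max_left x (1 / x)).trans_lt hn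
      have h2 := (le_max_right x (1 / x)).trans_lt hn
      refine ⟨n, ?_, by linarith⟩
      rw [div_lt_iff₀ (by positivity)]
      rw [div_lt_iff₀ hx] at h2
      nlinarith
    · rintro ⟨n, hn, -⟩
      exact lt_trans (by positivity) hn
  have hmono : Monotone fun n : ℕ => Ioc (1 / ((n : ℝ) + 1)) (n + 1) := by
    intro m n hmn
    have : (m : ℝ) ≤ n := by exact_mod_cast hmn
    exact Ioc_subset_Ioc (by gcongr) (by linarith)
  rw [hU, setLIntegral_iUnion_of_directed _ (hmono.directed_le)]
  refine iSup_le fun n => htrunc _ _ (by positivity) ?_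
  rw [div_le_iff₀ (by positivity)]
  have : (0 : ℝ) ≤ n := n.cast_nonneg
  nlinarith

/-! ### Distributional derivatives and primitives -/

open Filter Topology Convolution ContinuousLinearMap in
/-- A continuous function whose distributional derivative vanishes is constant. -/
theorem HasDistribDeriv.eq_const {w : ℝ → ℝ} (hw : Continuous w)
    (h : HasDistribDeriv w fun _ => 0) (x y : ℝ) : w x = w y := by
  let ρ : ℕ → ContDiffBump (0 : ℝ) := fun n =>
    ⟨1 / ((n : ℝ) + 2), 1 / ((n : ℝ) + 1), by positivity,
      one_div_lt_one_div_of_lt (by positivity) (by linarith)⟩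
  have hρ : Tendsto (fun n => (ρ n).rOut) atTop (𝓝 0) := tendsto_one_div_add_atTop_nhds_zero_nat
  have hlim := fun z => ContDiffBump.convolution_tendsto_right_of_continuous (μ := volume) hρ hw z
  refine tendsto_nhds_unique (hlim x) ((tendsto_congr fun n => ?_).1 (hlim y))
  set η := (ρ n).normed volume with hη
  have hηc : HasCompactSupport η := (ρ n).hasCompactSupport_normed
  have hηs : ContDiff ℝ ∞ η := (ρ n).contDiff_normed
  -- The mollification of `w` has derivative `(η' ⋆ w)(z)`, which is up to sign the pairing of `w`
  -- with the derivative of the test function `t ↦ η (z - t)`; hence every mollification is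
  -- constant.
  have hd : ∀ z, HasDerivAt (η ⋆[lsmul ℝ ℝ, volume] w) 0 z := by
    intro z
    have h1 := hηc.hasDerivAt_convolution_left (lsmul ℝ ℝ)
      (hηs.of_le (by exact_mod_cast le_top)) hw.locallyIntegrable (μ := volume) z
    convert! h1
    rw [convolution_lsmul_swap]
    have h2 := h (fun t => η (z - t)) (hηs.comp (contDiff_const.sub contDiff_id))
      (hηc.comp_homeomorph (Homeomorph.subLeft z))
    simp only [zero_mul, integral_zero, neg_zero] at h2
    rw [← neg_zero, ← h2, ← integral_neg]
    refine integral_congr_ae (Eventually.of_forall fun t => ?_)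
    have h3 : deriv (fun t => η (z - t)) t = -deriv η (z - t) := deriv_comp_const_sub ..
    simp only [h3, smul_eq_mul]
    ring
  exact is_const_of_deriv_eq_zero (fun z => (hd z).differentiableAt) (fun z => (hd z).deriv) y x

/-- Integration by parts for absolutely continuous functions on an interval containing the support
of `φ`, with Lebesgue differentiation identifying the derivative almost everywhere. -/
theorem hasDistribDeriv_primitive {u : ℝ → ℝ} (hu : LocallyIntegrable u) :
    HasDistribDeriv (primitive u) u := by
  intro φ hφ hφc
  obtain ⟨R, hR⟩ := hφc.isCompact.isBounded.subset_closedBall 0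
  set S := max R 0 + 1 with hS
  have hS0 : 0 < S := by positivity
  have hRS : R < S := (le_max_left R 0).trans_lt (lt_add_one _)
  have hsupp : tsupport φ ⊆ Ioo (-S) S := fun x hx => by
    have := hR hx
    rw [Metric.mem_closedBall, dist_zero_right, Real.norm_eq_abs] at this
    exact abs_lt.1 (this.trans_lt hRS)
  have hz : ∀ x, x ∉ Ioo (-S) S → φ x = 0 := fun x hx =>
    image_eq_zero_of_notMem_tsupport fun h => hx (hsupp h)
  have hz' : ∀ x, x ∉ Ioo (-S) S → deriv φ x = 0 := fun x hx =>
    image_eq_zero_of_notMem_tsupport fun h => hx (hsupp (tsupport_deriv_subset h))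
  have hII : IntervalIntegrable u volume (-S) S :=
    (hu.integrableOn_isCompact isCompact_uIcc).intervalIntegrable
  have hUac : AbsolutelyContinuousOnInterval (primitive u) (-S) S :=
    hII.absolutelyContinuousOnInterval_intervalIntegral (by
      rw [uIcc_of_le (by linarith)]; exact ⟨by linarith, hS0.le⟩)
  have hφac : AbsolutelyContinuousOnInterval φ (-S) S :=
    (hφ.of_le (by exact_mod_cast le_top) : ContDiff ℝ 1 φ).contDiffOn.absolutelyContinuousOnInterval
  have key := hUac.integral_mul_deriv_eq_deriv_mul hφac
  rw [hz S (by simp), hz (-S) (by simp), mul_zero, mul_zero, sub_zero, zero_sub,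
    intervalIntegral.integral_of_le (by linarith), intervalIntegral.integral_of_le (by linarith),
    setIntegral_eq_integral_of_forall_compl_eq_zero,
    setIntegral_eq_integral_of_forall_compl_eq_zero] at key
  · rw [key]
    congr 1
    refine integral_congr_ae ?_
    filter_upwards [_root_.LocallyIntegrable.ae_hasDerivAt_integral hu] with x hx
    change deriv (fun y => ∫ t in (0 : ℝ)..y, u t) x * _ = _
    rw [(hx 0).deriv]
  · intro x hx
    rw [hz x fun h => hx ⟨h.1, h.2.le⟩, mul_zero]
  · intro x hx
    rw [hz' x fun h => hx ⟨h.1, h.2.le⟩, mul_zero]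

theorem HasDistribDeriv.eq_primitive_add_const {g u : ℝ → ℝ} (hg : Continuous g)
    (hu : LocallyIntegrable u) (h : HasDistribDeriv g u) (x : ℝ) :
    g x = primitive u x + g 0 := by
  have hU := continuous_primitive hu
  have hw : HasDistribDeriv (fun x => g x - primitive u x) fun _ => 0 := by
    intro φ hφ hφc
    have hd : Continuous (deriv φ) := hφ.continuous_deriv (by exact_mod_cast le_top)
    have hi : ∀ k : ℝ → ℝ, Continuous k → Integrable fun x => k x * deriv φ x := fun k hk =>
      (hk.mul hd).integrable_of_hasCompactSupport hφc.deriv.mul_left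
    simp only [sub_mul, zero_mul, integral_zero, neg_zero]
    rw [integral_sub (hi g hg) (hi _ hU), h φ hφ hφc, hasDistribDeriv_primitive hu φ hφ hφc,
      sub_self]
  have : g x - primitive u x = g 0 - primitive u 0 := hw.eq_const (hg.sub hU) x 0
  have h0 : primitive u 0 = 0 := by simp [primitive]
  linarith

/-! ### Necessity: the Carleson estimate for primitives of `BMO` functions -/

theorem setLIntegral_sq_le_bmoNorm (u : ℝ → ℝ) {a b : ℝ} (hab : a < b) :
    ∫⁻ x in Icc a b, ‖u x - ⨍ y in Icc a b, u y‖ₑ ^ 2 ≤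
      bmoNorm u ^ 2 * ENNReal.ofReal (b - a) := by
  have h1 : ((∫⁻ x in Icc a b, ENNReal.ofReal (|u x - ⨍ y in Icc a b, u y| ^ 2)) /
      ENNReal.ofReal (b - a)) ^ (1 / 2 : ℝ) ≤ bmoNorm u :=
    le_iSup_of_le a (le_iSup_of_le b (le_iSup_of_le hab le_rfl))
  have h2 := pow_le_pow_left' h1 2
  rw [← ENNReal.rpow_natCast, ← ENNReal.rpow_mul] at h2
  norm_num at h2
  rw [ENNReal.div_le_iff (by simpa using hab) (by simp)] at h2
  refine le_trans (le_of_eq ?_) h2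
  exact lintegral_congr fun x => by rw [enorm_sq_eq_ofReal]

theorem halfPlaneMeasure_inter_box {A : Set (ℝ × ℝ)} (hA : MeasurableSet A) (a b H : ℝ) :
    halfPlaneMeasure (A ∩ Icc a b ×ˢ Ioc 0 H) =
      ∫⁻ x in Icc a b, ∫⁻ h in Ioc 0 H,
        A.indicator (fun _ => (1 : ℝ≥0∞)) (x, h) / ENNReal.ofReal h := by
  rw [← Measure.restrict_apply hA, halfPlaneMeasure, ← Measure.prod_restrict,
    Measure.prod_apply hA]
  refine lintegral_congr fun x => ?_
  have hm : MeasurableSet (Prod.mk x ⁻¹' A) := measurable_prodMk_left hA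
  rw [← lintegral_indicator_one hm, setLIntegral_scaleMeasure (measurable_one.indicator hm)
    measurableSet_Ioc (fun h hh => hh.1)]
  refine lintegral_congr fun h => ?_
  rw [mul_comm, div_eq_mul_inv]
  rfl

theorem measurableSet_zygmundLargeSet {f : ℝ → ℝ} (hf : Continuous f) (ε : ℝ) :
    MeasurableSet (zygmundLargeSet f ε) :=
  (measurableSet_lt measurable_const measurable_snd).inter
    (measurableSet_lt measurable_const (measurable_secondDividedDiff hf).abs)

theorem zygmundDensity_eq {f : ℝ → ℝ} (hf : Continuous f) (ε a b : ℝ) :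
    zygmundDensity f ε a b =
      halfPlaneMeasure (zygmundLargeSet f ε ∩ Icc a b ×ˢ Ioc 0 (b - a)) /
        ENNReal.ofReal (b - a) := by
  rw [halfPlaneMeasure_inter_box (measurableSet_zygmundLargeSet hf ε)]
  rfl

theorem secondDividedDiff_sub (f g : ℝ → ℝ) (x h : ℝ) :
    secondDividedDiff (f - g) x h = secondDividedDiff f x h - secondDividedDiff g x h := by
  simp only [secondDividedDiff, Pi.sub_apply]
  ring

theorem ofReal_abs_secondDividedDiff_le (f : ℝ → ℝ) (x : ℝ) {h : ℝ} (hh : 0 < h) :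
    ENNReal.ofReal |secondDividedDiff f x h| ≤ zygmundSeminorm f :=
  le_iSup_of_le x (le_iSup_of_le h (le_iSup_of_le hh le_rfl))

/-- The second divided differences of a primitive of a `BMO` function define a Carleson measure. -/
theorem IBMO.setLIntegral_sq_secondDividedDiff_le {g u : ℝ → ℝ} (hg : Continuous g) (hu : u ∈ BMO)
    (hgu : HasDistribDeriv g u) {a b : ℝ} (hab : a < b) :
    ∫⁻ p in Icc a b ×ˢ Ioc 0 (b - a), ‖secondDividedDiff g p.1 p.2‖ₑ ^ 2 ∂halfPlaneMeasure ≤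
      12 * bmoNorm u ^ 2 * ENNReal.ofReal (b - a) := by
  obtain ⟨huloc, hutop⟩ := hu
  -- `[a', b']` is the concentric triple of `[a, b]`; it contains `x` and `x ± h` for every `(x, h)`
  -- in the box.
  set a' := 2 * a - b with ha'
  set b' := 2 * b - a with hb'
  set m := ⨍ y in Icc a' b', u y with hm
  set v : ℝ → ℝ := (Icc a' b').indicator fun x => u x - m with hv
  have hvint : ∫⁻ t, ‖v t‖ₑ ^ 2 ≤ bmoNorm u ^ 2 * ENNReal.ofReal (b' - a') := by
    refine le_trans (le_of_eq ?_) (setLIntegral_sq_le_bmoNorm u (show a' < b' by linarith))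
    rw [← lintegral_indicator measurableSet_Icc]
    refine lintegral_congr fun t => ?_
    by_cases ht : t ∈ Icc a' b' <;> simp [hv, ht, hm]
  have hvm : MemLp v 2 := by
    refine ⟨(huloc.aestronglyMeasurable.sub aestronglyMeasurable_const).indicator
      measurableSet_Icc, ?_⟩
    rw [eLpNorm_lt_top_iff_lintegral_rpow_enorm_lt_top (by norm_num) (by norm_num)]
    simp only [ENNReal.toReal_ofNat, ENNReal.rpow_ofNat]
    exact hvint.trans_lt (ENNReal.mul_lt_top (ENNReal.pow_lt_top hutop) (by simp))
  have hvloc : LocallyIntegrable v := hvm.locallyIntegrable (by norm_num)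
  have hII : ∀ x y, IntervalIntegrable u volume x y := fun x y =>
    (huloc.integrableOn_isCompact isCompact_uIcc).intervalIntegrable
  -- On the triple interval `g` and the primitive of `v` differ by an affine function of slope `m`,
  -- so their second differences agree.
  have hdiff : ∀ x y, x ∈ Icc a' b' → y ∈ Icc a' b' →
      g y - g x = primitive v y - primitive v x + m * (y - x) := by
    intro x y hx hy
    have e : ∫ t in x..y, v t = ∫ t in x..y, (u t - m) := by
      refine intervalIntegral.integral_congr fun t ht => ?_
      simp only [hv]
      exact indicator_of_mem ((convex_Icc a' b').ordConnected.uIcc_subset hx hy ht) _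
    rw [primitive_sub hvloc, e, intervalIntegral.integral_sub (hII x y) (by simp),
      hgu.eq_primitive_add_const hg huloc x, hgu.eq_primitive_add_const hg huloc y,
      add_sub_add_right_eq_sub, primitive_sub huloc]
    simp
    ring
  calc _ = ∫⁻ p in Icc a b ×ˢ Ioc 0 (b - a),
        ‖secondDividedDiff (primitive v) p.1 p.2‖ₑ ^ 2 ∂halfPlaneMeasure := by
        refine setLIntegral_congr_fun (measurableSet_Icc.prod measurableSet_Ioc) ?_
        rintro ⟨x, h⟩ ⟨⟨hx1, hx2⟩, ⟨hh1, hh2⟩⟩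
        dsimp only at *
        have h1 := hdiff x (x + h) ⟨by linarith, by linarith⟩ ⟨by linarith, by linarith⟩
        have h2 := hdiff x (x - h) ⟨by linarith, by linarith⟩ ⟨by linarith, by linarith⟩
        have : secondDividedDiff g x h = secondDividedDiff (primitive v) x h := by
          unfold secondDividedDiff
          congr 1
          linarith
        rw [this]
    _ ≤ ∫⁻ p, ‖secondDividedDiff (primitive v) p.1 p.2‖ₑ ^ 2 ∂halfPlaneMeasure :=
        setLIntegral_le_lintegral _ _
    _ ≤ 4 * (bmoNorm u ^ 2 * ENNReal.ofReal (b' - a')) :=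
        (lintegral_sq_secondDividedDiff_primitive_le hvm).trans (by gcongr)
    _ = _ := by
        rw [show b' - a' = 3 * (b - a) by rw [ha', hb']; ring, ENNReal.ofReal_mul (by norm_num)]
        rw [show ENNReal.ofReal 3 = 3 by simp]
        ring

theorem density_bound_of_mem_zygmundClosure {f : ℝ → ℝ} (hf : f ∈ zygmundClosure IBMO) {ε : ℝ}
    (hε : 0 < ε) :
    ∃ C : ℝ, 0 < C ∧ ∀ a b : ℝ, a < b → zygmundDensity f ε a b ≤ ENNReal.ofReal C := by
  obtain ⟨⟨hfc, -⟩, happ⟩ := hf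
  obtain ⟨g, ⟨⟨hgc, u, hu, hgu⟩, -⟩, hfg⟩ := happ (ε / 2) (by positivity)
  set D := 12 * bmoNorm u ^ 2 / ENNReal.ofReal ((ε / 2) ^ 2) with hD
  have hDtop : D ≠ ⊤ := ENNReal.div_ne_top
    (ENNReal.mul_ne_top (by simp) (ENNReal.pow_ne_top hu.2.ne)) (by simp; positivity)
  -- `D` is the Chebyshev constant at level `ε/2`; adding one only ensures positivity.
  refine ⟨D.toReal + 1, by positivity, fun a b hab => ?_⟩
  have hab' : ENNReal.ofReal (b - a) ≠ 0 := by simpa using hab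
  rw [zygmundDensity_eq hfc]
  refine ENNReal.div_le_of_le_mul ?_
  set S := Icc a b ×ˢ Ioc 0 (b - a) with hS
  have hsub : zygmundLargeSet f ε ∩ S ⊆
      {p | ENNReal.ofReal ((ε / 2) ^ 2) ≤ ‖secondDividedDiff g p.1 p.2‖ₑ ^ 2} ∩ S := by
    rintro ⟨x, h⟩ ⟨⟨hh, hlt⟩, hxS⟩
    refine ⟨?_, hxS⟩
    dsimp only at hh hlt
    have h1 : |secondDividedDiff (f - g) x h| < ε / 2 := by
      have := (ofReal_abs_secondDividedDiff_le (f - g) x hh).trans_lt hfg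
      exact (ENNReal.ofReal_lt_ofReal_iff (by positivity)).1 this
    rw [secondDividedDiff_sub] at h1
    have h2 : ε / 2 ≤ |secondDividedDiff g x h| := by
      have := abs_sub_abs_le_abs_sub (secondDividedDiff f x h) (secondDividedDiff g x h)
      linarith
    simp only [mem_ofPred_eq, enorm_sq_eq_ofReal]
    refine ENNReal.ofReal_le_ofReal ?_
    rw [← sq_abs (secondDividedDiff g x h)]
    gcongr
  have hmeas : Measurable fun p : ℝ × ℝ => ‖secondDividedDiff g p.1 p.2‖ₑ ^ 2 :=
    (measurable_secondDividedDiff hgc).enorm.pow_const 2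
  have hcheb : ENNReal.ofReal ((ε / 2) ^ 2) * halfPlaneMeasure (zygmundLargeSet f ε ∩ S) ≤
      12 * bmoNorm u ^ 2 * ENNReal.ofReal (b - a) := by
    refine le_trans ?_ (IBMO.setLIntegral_sq_secondDividedDiff_le hgc hu hgu hab)
    refine le_trans ?_ (mul_meas_ge_le_lintegral hmeas (ENNReal.ofReal ((ε / 2) ^ 2)))
    refine mul_le_mul_right ?_ _
    rw [Measure.restrict_apply (measurableSet_le measurable_const hmeas)]
    exact measure_mono hsub
  calc halfPlaneMeasure (zygmundLargeSet f ε ∩ S)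
      ≤ 12 * bmoNorm u ^ 2 * ENNReal.ofReal (b - a) / ENNReal.ofReal ((ε / 2) ^ 2) := by
        rw [ENNReal.le_div_iff_mul_le (Or.inl (by simp; positivity)) (Or.inl (by simp)), mul_comm]
        exact hcheb
    _ = D * ENNReal.ofReal (b - a) := by
        rw [hD, ENNReal.div_eq_inv_mul, ENNReal.div_eq_inv_mul]; ring
    _ ≤ _ := by
        gcongr
        rw [← ENNReal.ofReal_toReal hDtop]
        exact ENNReal.ofReal_le_ofReal (by simp)

/-! ### The tent kernel and its averages -/

/-- The tent function of width `h` and integral one. -/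
noncomputable def tent (h x : ℝ) : ℝ := (|x + h| - 2 * |x| + |x - h|) / (2 * h ^ 2)

/-- The average of `b` at the point `x` against the tent function of width `h`. -/
noncomputable def tentAverage (h : ℝ) (b : ℝ → ℝ) (x : ℝ) : ℝ := ∫ y, tent h (x - y) * b y

theorem continuous_tent (h : ℝ) : Continuous (tent h) := by
  unfold tent; fun_prop

theorem tent_nonneg (h x : ℝ) : 0 ≤ tent h x := by
  refine div_nonneg ?_ (by positivity)
  have := abs_add_le (x + h) (x - h)
  rw [show x + h + (x - h) = 2 * x by ring, abs_mul, abs_two] at this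
  linarith

theorem tent_neg (h x : ℝ) : tent h (-x) = tent h x := by
  unfold tent
  rw [abs_neg, show -x + h = -(x - h) by ring, show -x - h = -(x + h) by ring, abs_neg, abs_neg]
  ring

theorem tent_eq_zero {h x : ℝ} (hh : 0 < h) (hx : h ≤ |x|) : tent h x = 0 := by
  unfold tent
  rw [div_eq_zero_iff]
  left
  rcases le_abs.1 hx with hx | hx
  · rw [abs_of_nonneg (by linarith), abs_of_nonneg (by linarith : 0 ≤ x),
      abs_of_nonneg (by linarith)]
    ring
  · rw [abs_of_nonpos (by linarith), abs_of_nonpos (by linarith : x ≤ 0),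
      abs_of_nonpos (by linarith)]
    ring

theorem hasCompactSupport_tent {h : ℝ} (hh : 0 < h) : HasCompactSupport (tent h) := by
  refine HasCompactSupport.intro (isCompact_Icc (a := -h) (b := h)) fun x hx => ?_
  refine tent_eq_zero hh ?_
  by_contra hc
  exact hx ⟨(abs_lt.1 (not_le.1 hc)).1.le, (abs_lt.1 (not_le.1 hc)).2.le⟩

theorem integrable_tent {h : ℝ} (hh : 0 < h) : Integrable (tent h) :=
  (continuous_tent h).integrable_of_hasCompactSupport (hasCompactSupport_tent hh)

theorem integral_abs_zero_right {c : ℝ} (hc : 0 ≤ c) : ∫ x in (0 : ℝ)..c, |x| = c ^ 2 / 2 := by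
  have : ∫ x in (0 : ℝ)..c, |x| = ∫ x in (0 : ℝ)..c, x :=
    intervalIntegral.integral_congr fun x hx => abs_of_nonneg (by
      rw [uIcc_of_le hc] at hx; exact hx.1)
  rw [this, integral_id]
  ring

theorem integral_abs_zero_left {c : ℝ} (hc : 0 ≤ c) : ∫ x in -c..(0 : ℝ), |x| = c ^ 2 / 2 := by
  have := intervalIntegral.integral_comp_neg (a := 0) (b := c) fun x : ℝ => |x|
  simp only [abs_neg, neg_zero] at this
  rw [← this, integral_abs_zero_right hc]

theorem integral_tent {h : ℝ} (hh : 0 < h) : ∫ x, tent h x = 1 := by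
  have h1 : ∫ x, tent h x = ∫ x in -h..h, tent h x := by
    rw [intervalIntegral.integral_of_le (by linarith),
      setIntegral_eq_integral_of_forall_compl_eq_zero]
    intro x hx
    refine tent_eq_zero hh ?_
    by_contra hc
    exact hx ⟨(abs_lt.1 (not_le.1 hc)).1, (abs_lt.1 (not_le.1 hc)).2.le⟩
  have hi : ∀ k : ℝ → ℝ, Continuous k → IntervalIntegrable k volume (-h) h := fun k hk =>
    hk.intervalIntegrable _ _
  have e1 : ∫ x in -h..h, |x + h| = 2 * h ^ 2 := by
    rw [intervalIntegral.integral_comp_add_right (fun x => |x|) h, neg_add_cancel,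
      integral_abs_zero_right (by linarith)]
    ring
  have e2 : ∫ x in -h..h, |x - h| = 2 * h ^ 2 := by
    rw [intervalIntegral.integral_comp_sub_right (fun x => |x|) h, sub_self,
      show -h - h = -(2 * h) by ring, integral_abs_zero_left (by linarith)]
    ring
  have e3 : ∫ x in -h..h, |x| = h ^ 2 := by
    rw [← intervalIntegral.integral_add_adjacent_intervals (b := 0)
      (continuous_abs.intervalIntegrable _ _) (continuous_abs.intervalIntegrable _ _),
      integral_abs_zero_left hh.le, integral_abs_zero_right hh.le]
    ring
  rw [h1]
  unfold tent
  rw [intervalIntegral.integral_div, intervalIntegral.integral_add (hi _ (by fun_prop))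
    (hi _ (by fun_prop)), intervalIntegral.integral_sub (hi _ (by fun_prop)) (hi _ (by fun_prop)),
    intervalIntegral.integral_const_mul, e1, e2, e3]
  field_simp
  ring

/-- `h ^ 2 * tent h` is the second difference of step `h` of `|x| / 2`, and second differences of
steps `h` and `r` commute. -/
theorem sq_mul_secondDiff_tent {h r : ℝ} (hh : h ≠ 0) (hr : r ≠ 0) (x : ℝ) :
    tent h (x + r) - 2 * tent h x + tent h (x - r) =
      r ^ 2 / h ^ 2 * (tent r (x + h) - 2 * tent r x + tent r (x - h)) := by
  unfold tent
  rw [show x + r + h = x + h + r by ring, show x + r - h = x - h + r by ring,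
    show x - r + h = x + h - r by ring, show x - r - h = x - h - r by ring]
  field_simp
  ring

/-- With `τ` the translation by `h`, this is the factorisation `τ² - 2 + τ⁻² = (τ - 2 + τ⁻¹)(τ + 2 +
τ⁻¹)`, applied to `|x|`. -/
theorem tent_two_mul {h : ℝ} (x : ℝ) :
    tent (2 * h) x = (tent h (x + h) + 2 * tent h x + tent h (x - h)) / 4 := by
  unfold tent
  rw [show x + h + h = x + 2 * h by ring, show x + h - h = x by ring,
    show x - h + h = x by ring, show x - h - h = x - 2 * h by ring]
  ring

theorem integral_tent_sub {h : ℝ} (hh : 0 < h) (x : ℝ) : ∫ y, tent h (x - y) = 1 := by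
  rw [integral_sub_left_eq_self (tent h) volume x, integral_tent hh]

theorem integral_secondDiff {α : Type*} [MeasurableSpace α] {μ : Measure α} {f g k : α → ℝ}
    (hf : Integrable f μ) (hg : Integrable g μ) (hk : Integrable k μ) :
    (∫ x, f x ∂μ) - 2 * (∫ x, g x ∂μ) + (∫ x, k x ∂μ) = ∫ x, (f x - 2 * g x + k x) ∂μ := by
  rw [integral_add (f := fun x => f x - 2 * g x) (hf.sub (hg.const_mul 2)) hk,
    integral_sub hf (hg.const_mul 2), integral_const_mul]

section Bounded

variable {b : ℝ → ℝ} {B : ℝ}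

theorem integrable_tent_sub_mul (hb : Measurable b) (hB : ∀ y, |b y| ≤ B) {h : ℝ} (hh : 0 < h)
    (x : ℝ) : Integrable fun y => tent h (x - y) * b y :=
  ((integrable_tent hh).comp_sub_left x).mul_bdd hb.aestronglyMeasurable
    (Filter.Eventually.of_forall hB)

theorem abs_tentAverage_le (hB : ∀ y, |b y| ≤ B) {h : ℝ} (hh : 0 < h) (x : ℝ) :
    |tentAverage h b x| ≤ B := by
  have h1 := norm_integral_le_of_norm_le (f := fun y => tent h (x - y) * b y)
    (((integrable_tent hh).comp_sub_left x).mul_const B) (Filter.Eventually.of_forall fun y => by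
      rw [norm_mul, Real.norm_of_nonneg (tent_nonneg _ _)]
      exact mul_le_mul_of_nonneg_left (hB y) (tent_nonneg _ _))
  rwa [integral_mul_const, integral_tent_sub hh, one_mul] at h1

theorem tentAverage_add_right (b : ℝ → ℝ) (h x r : ℝ) :
    tentAverage h b (x + r) = tentAverage h (fun y => b (y + r)) x := by
  unfold tentAverage
  rw [← integral_add_right_eq_self _ r]
  simp [add_sub_add_right_eq_sub]

theorem secondDiff_tentAverage (hb : Measurable b) (hB : ∀ y, |b y| ≤ B) {h r : ℝ} (hh : 0 < h)
    (hr : 0 < r) (x : ℝ) :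
    tentAverage h b (x + r) - 2 * tentAverage h b x + tentAverage h b (x - r) =
      r ^ 2 / h ^ 2 *
        (tentAverage r b (x + h) - 2 * tentAverage r b x + tentAverage r b (x - h)) := by
  have hi := fun z => integrable_tent_sub_mul hb hB hh z
  have hi' := fun z => integrable_tent_sub_mul hb hB hr z
  unfold tentAverage
  rw [integral_secondDiff (hi _) (hi _) (hi _), integral_secondDiff (hi' _) (hi' _) (hi' _),
    ← integral_const_mul]
  congr 1
  ext y
  have := sq_mul_secondDiff_tent hh.ne' hr.ne' (x - y)
  rw [show x - y + r = x + r - y by ring, show x - y - r = x - r - y by ring,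
    show x - y + h = x + h - y by ring, show x - y - h = x - h - y by ring] at this
  linear_combination b y * this

theorem abs_secondDiff_le_four_mul {u v w B : ℝ} (hu : |u| ≤ B) (hv : |v| ≤ B) (hw : |w| ≤ B) :
    |u - 2 * v + w| ≤ 4 * B := by
  rw [abs_le] at *
  constructor <;> linarith [hu.1, hu.2, hv.1, hv.2, hw.1, hw.2]

/-- Besides the trivial bound, exchanging the roles of `h` and `r` gains the factor `r ^ 2 / h ^ 2`;
this decay at coarse scales is what makes superpositions belong to the Zygmund class. -/
theorem abs_secondDiff_tentAverage_le (hb : Measurable b) (hB : ∀ y, |b y| ≤ B) {h r : ℝ}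
    (hh : 0 < h) (hr : 0 < r) (x : ℝ) :
    |tentAverage h b (x + r) - 2 * tentAverage h b x + tentAverage h b (x - r)| ≤
      4 * B * min 1 (r ^ 2 / h ^ 2) := by
  have hB0 : 0 ≤ B := (abs_nonneg _).trans (hB 0)
  have h1 := fun z => abs_tentAverage_le hB hh z
  have h2 := fun z => abs_tentAverage_le hB hr z
  rw [mul_min_of_nonneg _ _ (by positivity), mul_one]
  refine le_min (abs_secondDiff_le_four_mul (h1 _) (h1 _) (h1 _)) ?_
  rw [secondDiff_tentAverage hb hB hh hr, abs_mul, abs_of_nonneg (by positivity), mul_comm]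
  exact mul_le_mul_of_nonneg_right (abs_secondDiff_le_four_mul (h2 _) (h2 _) (h2 _))
    (by positivity)

/-- The weights `1, 2, 1` over four express the average of width `2h` through translates of that of
width `h`. The difference is therefore `-1/4` of a second difference, and translation invariance
moves it onto `f`. -/
theorem tentAverage_sub_two_mul {f : ℝ → ℝ} (hf : Measurable f) (hB : ∀ y, |f y| ≤ B) {h : ℝ}
    (hh : 0 < h) (x : ℝ) :
    tentAverage h f x - tentAverage (2 * h) f x =
      -(h / 4) * tentAverage h (fun y => secondDividedDiff f y h) x := by
  have hi := fun z => integrable_tent_sub_mul hf hB hh z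
  have hi2 : ∀ r, Integrable fun y => tent h (x - y) * f (y + r) := fun r =>
    integrable_tent_sub_mul (hf.comp (measurable_add_const r)) (fun y => hB _) hh x
  have e1 : tentAverage (2 * h) f x =
      (tentAverage h f (x + h) + 2 * tentAverage h f x + tentAverage h f (x - h)) / 4 := by
    unfold tentAverage
    rw [← integral_const_mul, ← integral_add (hi _) ((hi _).const_mul 2),
      ← integral_add (f := fun y => tent h (x + h - y) * f y + 2 * (tent h (x - y) * f y))
        ((hi _).add ((hi _).const_mul 2)) (hi _), ← integral_div]
    congr 1
    ext y
    rw [tent_two_mul, show x - y + h = x + h - y by ring, show x - y - h = x - h - y by ring]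
    ring
  have e2 : h * tentAverage h (fun y => secondDividedDiff f y h) x =
      tentAverage h f (x + h) - 2 * tentAverage h f x + tentAverage h f (x - h) := by
    rw [sub_eq_add_neg x h, tentAverage_add_right, tentAverage_add_right]
    unfold tentAverage
    rw [integral_secondDiff (hi2 h) (hi x) (hi2 (-h)), ← integral_const_mul]
    congr 1
    ext y
    unfold secondDividedDiff
    field_simp
    ring_nf
  rw [e1]
  linear_combination (1 / 4 : ℝ) * e2

theorem continuous_tentAverage (hb : Measurable b) (hB : ∀ y, |b y| ≤ B) {h : ℝ} (hh : 0 < h) :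
    Continuous (tentAverage h b) := by
  have hloc : LocallyIntegrable b := by
    refine (locallyIntegrable_const B).mono hb.aestronglyMeasurable
      (Filter.Eventually.of_forall fun y => ?_)
    exact (hB y).trans (le_abs_self B)
  have := (hasCompactSupport_tent hh).continuous_convolution_left (ContinuousLinearMap.mul ℝ ℝ)
    (continuous_tent h) hloc
  convert this using 1
  ext x
  rw [convolution_mul_swap]
  rfl

end Bounded

open Filter Topology in
theorem tendsto_tentAverage {f : ℝ → ℝ} (hf : Continuous f) {B : ℝ} (hB : ∀ y, |f y| ≤ B) (x : ℝ) :
    Tendsto (fun h => tentAverage h f x) (𝓝[>] 0) (𝓝 (f x)) := by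
  rw [Metric.tendsto_nhdsWithin_nhds]
  intro ε hε
  obtain ⟨δ, hδ, hδf⟩ := Metric.continuous_iff.1 hf x (ε / 2) (by positivity)
  refine ⟨δ, hδ, fun h hh hhδ => ?_⟩
  have hh0 : 0 < h := hh
  rw [Real.dist_eq, sub_zero, abs_of_pos hh0] at hhδ
  have hi := integrable_tent_sub_mul hf.measurable hB hh0 x
  have hi1 : Integrable fun y => tent h (x - y) := (integrable_tent hh0).comp_sub_left x
  have e : tentAverage h f x - f x = ∫ y, tent h (x - y) * (f y - f x) := by
    simp only [mul_sub]
    rw [integral_sub hi (hi1.mul_const _), integral_mul_const, integral_tent_sub hh0, one_mul]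
    rfl
  rw [Real.dist_eq, e]
  have h1 := norm_integral_le_of_norm_le (f := fun y => tent h (x - y) * (f y - f x))
    (hi1.mul_const (ε / 2)) (Filter.Eventually.of_forall fun y => by
      rw [norm_mul, Real.norm_of_nonneg (tent_nonneg _ _)]
      rcases lt_or_ge |x - y| h with hxy | hxy
      · refine mul_le_mul_of_nonneg_left (hδf y ?_).le (tent_nonneg _ _)
        rw [Real.dist_eq, abs_sub_comm]
        linarith
      · rw [tent_eq_zero hh0 hxy, zero_mul, zero_mul])
  rw [integral_mul_const, integral_tent_sub hh0, one_mul] at h1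
  exact lt_of_le_of_lt h1 (by linarith)

theorem measurable_tent : Measurable fun p : ℝ × ℝ => tent p.1 p.2 := by
  unfold tent; fun_prop

theorem stronglyMeasurable_tentAverage {a : ℝ × ℝ → ℝ} (ha : Measurable a) :
    StronglyMeasurable fun p : ℝ × ℝ => tentAverage p.1 (fun y => a (y, p.1)) p.2 := by
  refine StronglyMeasurable.integral_prod_right
    (f := fun (p : ℝ × ℝ) (y : ℝ) => tent p.1 (p.2 - y) * a (y, p.1)) ?_
  refine Measurable.stronglyMeasurable ?_
  refine Measurable.mul ?_ (by fun_prop)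
  exact measurable_tent.comp (f := fun q : (ℝ × ℝ) × ℝ => (q.1.1, q.1.2 - q.2)) (by fun_prop)

theorem measurable_tentAverage_scale {a : ℝ × ℝ → ℝ} (ha : Measurable a) (x : ℝ) :
    Measurable fun h : ℝ => tentAverage h (fun y => a (y, h)) x :=
  (stronglyMeasurable_tentAverage ha).measurable.comp (f := fun h => (h, x)) (by fun_prop)

/-! ### Superposition of tent averages over scales -/

/-- The superposition over the scales `0 < h ≤ H` of the tent averages of `a (·, h)`. -/
noncomputable def tentSynthesis (H : ℝ) (a : ℝ × ℝ → ℝ) (x : ℝ) : ℝ :=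
  ∫ h in Ioc 0 H, tentAverage h (fun y => a (y, h)) x

section Synthesis

variable {a : ℝ × ℝ → ℝ} {B : ℝ}

theorem integrableOn_tentAverage (ha : Measurable a) (hB : ∀ x h, 0 < h → |a (x, h)| ≤ B)
    (H x : ℝ) : IntegrableOn (fun h => tentAverage h (fun y => a (y, h)) x) (Ioc 0 H) := by
  refine Measure.integrableOn_of_bounded (M := B) (by simp)
    (measurable_tentAverage_scale ha x).aestronglyMeasurable ?_
  filter_upwards [ae_restrict_mem measurableSet_Ioc] with h hh
  exact abs_tentAverage_le (fun y => hB y h hh.1) hh.1 x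

theorem continuous_tentSynthesis (ha : Measurable a) (hB : ∀ x h, 0 < h → |a (x, h)| ≤ B) (H : ℝ) :
    Continuous (tentSynthesis H a) := by
  refine continuous_of_dominated (bound := fun _ => B)
    (fun x => (measurable_tentAverage_scale ha x).aestronglyMeasurable) (fun x => ?_)
    (integrable_const B) ?_
  · filter_upwards [ae_restrict_mem measurableSet_Ioc] with h hh
    exact abs_tentAverage_le (fun y => hB y h hh.1) hh.1 x
  · filter_upwards [ae_restrict_mem measurableSet_Ioc] with h hh
    exact continuous_tentAverage (by fun_prop) (fun y => hB y h hh.1) hh.1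

/-- The integrand is a majorant of `min 1 (r ^ 2 / h ^ 2)` with an elementary antiderivative. -/
theorem integral_four_mul_sq_div_le {r H : ℝ} (hr : 0 < r) (hH : 0 ≤ H) :
    ∫ h in Ioc 0 H, 4 * r ^ 2 / (h + r) ^ 2 ≤ 4 * r := by
  have hpos : ∀ h ∈ uIcc 0 H, h + r ≠ 0 := fun h hh => by
    rw [uIcc_of_le hH] at hh
    linarith [hh.1]
  have key : ∫ h in (0 : ℝ)..H, 4 * r ^ 2 / (h + r) ^ 2 =
      -(4 * r ^ 2 / (H + r)) - -(4 * r ^ 2 / (0 + r)) := by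
    refine intervalIntegral.integral_eq_sub_of_hasDerivAt (f := fun h => -(4 * r ^ 2 / (h + r)))
      (fun h hh => ?_) (ContinuousOn.intervalIntegrable ?_)
    · have := (((hasDerivAt_id h).add_const r).inv (hpos h hh)).const_mul (-(4 * r ^ 2))
      convert! this using 1
      · ext; simp [div_eq_mul_inv]
      · simp only [id]; ring
    · exact ContinuousOn.div (by fun_prop) (by fun_prop) fun h hh => pow_ne_zero 2 (hpos h hh)
  rw [← intervalIntegral.integral_of_le hH, key]
  have : 0 ≤ 4 * r ^ 2 / (H + r) := by positivity
  have h2 : 4 * r ^ 2 / (0 + r) = 4 * r := by field_simp; ring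
  linarith

/-- Scales below `r` contribute `O(r)` by their number and scales above `r` by their decay, so the
bound does not depend on `H`. The constant is the product of the `4` of a second difference and the
`4` of the majorant's integral. -/
theorem abs_secondDividedDiff_tentSynthesis_le (ha : Measurable a)
    (hB : ∀ x h, 0 < h → |a (x, h)| ≤ B) {H : ℝ} (hH : 0 ≤ H) (x : ℝ) {r : ℝ} (hr : 0 < r) :
    |secondDividedDiff (tentSynthesis H a) x r| ≤ 16 * B := by
  have hB0 : 0 ≤ B := (abs_nonneg _).trans (hB 0 1 one_pos)
  have hi := integrableOn_tentAverage ha hB H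
  unfold secondDividedDiff tentSynthesis
  rw [abs_div, abs_of_pos hr, div_le_iff₀ hr,
    integral_secondDiff (hi _) (hi _) (hi _)]
  have hint : IntegrableOn (fun h => 4 * B * (4 * r ^ 2 / (h + r) ^ 2)) (Ioc 0 H) := by
    refine (ContinuousOn.integrableOn_Icc ?_).mono_set Ioc_subset_Icc_self
    refine ContinuousOn.mul (by fun_prop) (ContinuousOn.div (by fun_prop) (by fun_prop) ?_)
    intro h hh
    have := hh.1
    positivity
  rw [← Real.norm_eq_abs]
  refine (norm_integral_le_of_norm_le hint ?_).trans ?_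
  · filter_upwards [ae_restrict_mem measurableSet_Ioc] with h hh
    refine (abs_secondDiff_tentAverage_le (by fun_prop) (fun y => hB y h hh.1) hh.1 hr x).trans ?_
    have h0 := hh.1
    refine mul_le_mul_of_nonneg_left ?_ (by positivity)
    rcases le_total h r with hle | hle
    · refine (min_le_left _ _).trans ?_
      rw [le_div_iff₀ (by positivity)]
      nlinarith
    · refine (min_le_right _ _).trans ?_
      rw [div_le_div_iff₀ (by positivity) (by positivity)]
      have : (h + r) ^ 2 ≤ 4 * h ^ 2 := by nlinarith
      nlinarith [sq_nonneg r]
  · rw [integral_const_mul]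
    calc 4 * B * ∫ h in Ioc 0 H, 4 * r ^ 2 / (h + r) ^ 2 ≤ 4 * B * (4 * r) := by
          gcongr; exact integral_four_mul_sq_div_le hr hH
      _ = 16 * B * r := by ring

theorem tentSynthesis_add {a' : ℝ × ℝ → ℝ} {B' : ℝ} (ha : Measurable a)
    (hB : ∀ x h, 0 < h → |a (x, h)| ≤ B) (ha' : Measurable a')
    (hB' : ∀ x h, 0 < h → |a' (x, h)| ≤ B') (H x : ℝ) :
    tentSynthesis H (fun p => a p + a' p) x = tentSynthesis H a x + tentSynthesis H a' x := by
  unfold tentSynthesis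
  rw [← integral_add (integrableOn_tentAverage ha hB H x) (integrableOn_tentAverage ha' hB' H x)]
  refine setIntegral_congr_fun measurableSet_Ioc fun h hh => ?_
  unfold tentAverage
  simp only [mul_add]
  exact integral_add (integrable_tent_sub_mul (by fun_prop) (fun y => hB y h hh.1) hh.1 x)
    (integrable_tent_sub_mul (by fun_prop) (fun y => hB' y h hh.1) hh.1 x)

end Synthesis

/-! ### The reproducing formula -/

section Reproducing

variable {f : ℝ → ℝ} {B : ℝ}

theorem intervalIntegrable_tentAverage_div (hf : Continuous f) (hB : ∀ y, |f y| ≤ B) (x : ℝ)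
    {α β : ℝ} (hα : 0 < α) (hβ : 0 < β) :
    IntervalIntegrable (fun h => tentAverage h f x / h) volume α β := by
  have hfm := hf.measurable
  rw [intervalIntegrable_iff]
  refine Measure.integrableOn_of_bounded (M := B / min α β) (by simp) ?_ ?_
  · exact ((measurable_tentAverage_scale (a := fun p => f p.1) (by fun_prop) x).div
      measurable_id).aestronglyMeasurable
  · filter_upwards [ae_restrict_mem measurableSet_uIoc] with h hh
    have hm : 0 < min α β := lt_min hα hβ
    have h0 : 0 < h := hm.trans hh.1
    rw [norm_div, Real.norm_eq_abs, Real.norm_of_nonneg h0.le]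
    exact div_le_div₀ ((abs_nonneg _).trans (hB 0)) (abs_tentAverage_le hB h0 x) hm hh.1.le

/-- Integrated form of the relation between widths `h` and `2h`: invariance of `dh/h` telescopes the
left side, and the factor `h` on the right cancels the weight. -/
theorem integral_tentAverage_div_sub (hf : Continuous f) (hB : ∀ y, |f y| ≤ B) (x : ℝ)
    {δ H : ℝ} (hδ : 0 < δ) (hH : δ ≤ H) :
    (∫ h in δ..2 * δ, tentAverage h f x / h) - ∫ h in H..2 * H, tentAverage h f x / h =
      -(1 / 4) * ∫ h in δ..H, tentAverage h (fun y => secondDividedDiff f y h) x := by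
  have hH0 : 0 < H := hδ.trans_le hH
  have hi := fun α β => intervalIntegrable_tentAverage_div hf hB x (α := α) (β := β)
  have e1 : ∫ h in 2 * δ..2 * H, tentAverage h f x / h =
      ∫ h in δ..H, tentAverage (2 * h) f x / h := by
    have := intervalIntegral.mul_integral_comp_mul_left (a := δ) (b := H)
      (f := fun h => tentAverage h f x / h) 2
    rw [← this, ← intervalIntegral.integral_const_mul]
    refine intervalIntegral.integral_congr fun h hh => ?_
    rw [mul_div_assoc', mul_div_mul_left _ _ two_ne_zero]
  have hi2 : IntervalIntegrable (fun h => tentAverage (2 * h) f x / h) volume δ H := by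
    have := ((hi (2 * δ) (2 * H) (by positivity) (by positivity)).comp_mul_left
      (c := 2)).const_mul 2
    simp only [mul_div_cancel_left₀ _ (two_ne_zero' ℝ)] at this
    refine this.congr fun h _ => ?_
    rw [mul_div_assoc', mul_div_mul_left _ _ two_ne_zero]
  rw [intervalIntegral.integral_interval_sub_interval_comm (hi _ _ hδ (by positivity))
    (hi _ _ hH0 (by positivity)) (hi _ _ hδ hH0), e1,
    ← intervalIntegral.integral_sub (hi _ _ hδ hH0) hi2,
    ← intervalIntegral.integral_const_mul]
  refine intervalIntegral.integral_congr fun h hh => ?_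
  rw [uIcc_of_le hH] at hh
  have h0 : 0 < h := hδ.trans_le hh.1
  rw [← sub_div, tentAverage_sub_two_mul hf.measurable hB h0]
  field_simp

open Filter Topology in
-- The substitution `h = δt` turns this into the integral of `tentAverage (δ * t) f x / t` over `[1,
-- 2]`, to which dominated convergence applies.
theorem tendsto_integral_tentAverage_div (hf : Continuous f) (hB : ∀ y, |f y| ≤ B) (x : ℝ) :
    Tendsto (fun δ => ∫ h in δ..2 * δ, tentAverage h f x / h) (𝓝[>] 0)
      (𝓝 (Real.log 2 * f x)) := by
  have hfm := hf.measurable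
  have e : ∀ᶠ δ in 𝓝[>] (0 : ℝ), ∫ t in (1 : ℝ)..2, tentAverage (δ * t) f x / t =
      ∫ h in δ..2 * δ, tentAverage h f x / h := by
    filter_upwards [self_mem_nhdsWithin] with δ hδ
    have hδ0 : δ ≠ 0 := ne_of_gt hδ
    have := intervalIntegral.mul_integral_comp_mul_left (a := 1) (b := 2)
      (f := fun h => tentAverage h f x / h) δ
    rw [mul_one, mul_comm δ 2] at this
    rw [← this, ← intervalIntegral.integral_const_mul]
    refine intervalIntegral.integral_congr fun h hh => ?_
    rw [mul_div_assoc', mul_div_mul_left _ _ hδ0]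
  refine Tendsto.congr' e ?_
  have hlog : Real.log 2 * f x = ∫ t in (1 : ℝ)..2, f x / t := by
    simp only [div_eq_mul_inv]
    rw [intervalIntegral.integral_const_mul, integral_inv_of_pos one_pos two_pos, div_one, mul_comm]
  rw [hlog]
  refine intervalIntegral.tendsto_integral_filter_of_dominated_convergence (fun _ => B) ?_ ?_
    (by simp) ?_
  · refine Eventually.of_forall fun δ => Measurable.aestronglyMeasurable ?_
    have := (measurable_tentAverage_scale (a := fun p => f p.1) (by fun_prop) x)
    exact (this.comp (measurable_const_mul δ)).div measurable_id
  · filter_upwards [self_mem_nhdsWithin] with δ hδ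
    refine Eventually.of_forall fun t ht => ?_
    rw [uIoc_of_le one_le_two] at ht
    have h0 : 0 < t := one_pos.trans ht.1
    rw [norm_div, Real.norm_eq_abs, Real.norm_of_nonneg h0.le, div_le_iff₀ h0]
    refine (abs_tentAverage_le hB (mul_pos hδ h0) x).trans ?_
    exact le_mul_of_one_le_right ((abs_nonneg _).trans (hB 0)) ht.1.le
  · refine Eventually.of_forall fun t ht => ?_
    rw [uIoc_of_le one_le_two] at ht
    have h0 : 0 < t := one_pos.trans ht.1
    refine Tendsto.div_const ((tendsto_tentAverage hf hB x).comp ?_) t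
    refine tendsto_nhdsWithin_iff.2 ⟨?_, ?_⟩
    · have : Tendsto (fun δ : ℝ => δ * t) (𝓝 0) (𝓝 (0 * t)) := tendsto_id.mul_const t
      rw [zero_mul] at this
      exact this.mono_left nhdsWithin_le_nhds
    · filter_upwards [self_mem_nhdsWithin] with δ hδ using mul_pos hδ h0

open Filter Topology in
/-- Reproducing formula: a bounded continuous function is recovered from its tent averages at the
scales in `[H, 2H]` and from its second divided differences at the scales below `H`. -/
theorem log_two_mul_eq (hf : Continuous f) (hB : ∀ y, |f y| ≤ B) {M : ℝ}
    (hM : ∀ x h, 0 < h → |secondDividedDiff f x h| ≤ M) {H : ℝ} (hH : 0 < H) (x : ℝ) :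
    Real.log 2 * f x = (∫ h in H..2 * H, tentAverage h f x / h) -
      1 / 4 * tentSynthesis H (fun p => secondDividedDiff f p.1 p.2) x := by
  have hM0 : 0 ≤ M := (abs_nonneg _).trans (hM 0 1 one_pos)
  have hQ := integrableOn_tentAverage (measurable_secondDividedDiff hf) hM H x
  set Q := fun h => tentAverage h (fun y => secondDividedDiff f y h) x with hQdef
  have hQi : ∀ δ ∈ Icc 0 H, ∀ δ' ∈ Icc 0 H, IntervalIntegrable Q volume δ δ' := by
    intro δ hδ δ' hδ'
    rw [intervalIntegrable_iff]
    exact hQ.mono_set (Ioc_subset_Ioc (le_min hδ.1 hδ'.1) (max_le hδ.2 hδ'.2))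
  -- The omitted scales `(0, δ]` contribute at most `M * δ`.
  have hlimQ : Tendsto (fun δ => ∫ h in δ..H, Q h) (𝓝[>] 0)
      (𝓝 (tentSynthesis H (fun p => secondDividedDiff f p.1 p.2) x)) := by
    rw [tendsto_iff_norm_sub_tendsto_zero]
    have hlin : Tendsto (fun δ : ℝ => M * |δ - 0|) (𝓝[>] 0) (𝓝 0) := by
      have : Tendsto (fun δ : ℝ => M * |δ - 0|) (𝓝 0) (𝓝 (M * |(0 : ℝ) - 0|)) :=
        Continuous.tendsto (by fun_prop) 0
      simpa using this.mono_left nhdsWithin_le_nhds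
    refine squeeze_zero' (Eventually.of_forall fun _ => norm_nonneg _) ?_ hlin
    filter_upwards [Ioo_mem_nhdsGT hH] with δ hδ
    have hd : (∫ h in δ..H, Q h) - tentSynthesis H (fun p => secondDividedDiff f p.1 p.2) x =
        -∫ h in (0 : ℝ)..δ, Q h := by
      have h1 : tentSynthesis H (fun p => secondDividedDiff f p.1 p.2) x =
          ∫ h in (0 : ℝ)..H, Q h := (intervalIntegral.integral_of_le hH.le).symm
      rw [h1, ← intervalIntegral.integral_add_adjacent_intervals
        (hQi 0 ⟨le_rfl, hH.le⟩ δ ⟨hδ.1.le, hδ.2.le⟩) (hQi δ ⟨hδ.1.le, hδ.2.le⟩ H ⟨hH.le, le_rfl⟩)]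
      ring
    rw [hd, norm_neg]
    refine intervalIntegral.norm_integral_le_of_norm_le_const fun h hh => ?_
    rw [uIoc_of_le hδ.1.le] at hh
    exact abs_tentAverage_le (fun y => hM y h hh.1) hh.1 x
  have hlim := ((tendsto_integral_tentAverage_div hf hB x).sub_const
    (∫ h in H..2 * H, tentAverage h f x / h))
  have hlim2 := hlimQ.const_mul (-(1 / 4) : ℝ)
  have := tendsto_nhds_unique_of_eventuallyEq hlim hlim2 (by
    filter_upwards [Ioo_mem_nhdsGT hH] with δ hδ
    exact integral_tentAverage_div_sub hf hB x hδ.1 hδ.2.le)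
  linarith

/-- The coarse-scale term is negligible for large `H`: since `min 1 (r²/h²) ≤ r/h`, the integrand is
at most `4Br/H²` on an interval of length `H`. -/
theorem abs_secondDividedDiff_integral_tentAverage_le (hf : Continuous f) (hB : ∀ y, |f y| ≤ B)
    {H : ℝ} (hH : 0 < H) (x : ℝ) {r : ℝ} (hr : 0 < r) :
    |secondDividedDiff (fun x => ∫ h in H..2 * H, tentAverage h f x / h) x r| ≤ 4 * B / H := by
  have hB0 : 0 ≤ B := (abs_nonneg _).trans (hB 0)
  have hi := fun x => (intervalIntegrable_tentAverage_div hf hB x hH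
    (show 0 < 2 * H by positivity)).1
  have hle : H ≤ 2 * H := by linarith
  unfold secondDividedDiff
  simp only [intervalIntegral.integral_of_le hle]
  rw [abs_div, abs_of_pos hr, div_le_iff₀ hr, integral_secondDiff (hi _) (hi _) (hi _),
    ← intervalIntegral.integral_of_le hle, ← Real.norm_eq_abs]
  refine (intervalIntegral.norm_integral_le_of_norm_le_const (C := 4 * B * r / H ^ 2)
    fun h hh => ?_).trans_eq ?_
  · rw [uIoc_of_le hle] at hh
    have h0 : 0 < h := hH.trans hh.1
    rw [mul_div_assoc', ← sub_div, ← add_div, norm_div, Real.norm_eq_abs,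
      Real.norm_of_nonneg h0.le]
    calc _ ≤ 4 * B * min 1 (r ^ 2 / h ^ 2) / h := by
          gcongr
          exact abs_secondDiff_tentAverage_le hf.measurable hB h0 hr x
      _ ≤ 4 * B * (r / h) / h := by
          gcongr
          rcases le_total r h with hrh | hrh
          · refine (min_le_right _ _).trans ?_
            rw [← div_pow, sq]
            exact mul_le_of_le_one_left (by positivity) ((div_le_one h0).2 hrh)
          · exact (min_le_left _ _).trans ((one_le_div h0).2 hrh)
      _ = 4 * B * r / h ^ 2 := by field_simp
      _ ≤ 4 * B * r / H ^ 2 := by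
          have := hh.1.le
          gcongr
  · rw [abs_of_nonneg (by linarith)]
    field_simp
    ring

end Reproducing

/-! ### Riesz representation of the pairing with `Δ₂` -/

theorem lintegral_sq_enorm_ne_top {α : Type*} [MeasurableSpace α] {μ : Measure α} {v : α → ℝ}
    (hv : MemLp v 2 μ) : ∫⁻ x, ‖v x‖ₑ ^ 2 ∂μ ≠ ⊤ := by
  have := hv.2
  rw [eLpNorm_lt_top_iff_lintegral_rpow_enorm_lt_top (by norm_num) (by norm_num)] at this
  simpa using this.ne

theorem memLp_two_of_lintegral_sq_ne_top {α : Type*} [MeasurableSpace α] {μ : Measure α}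
    {v : α → ℝ} (hv : AEStronglyMeasurable v μ) (h : ∫⁻ x, ‖v x‖ₑ ^ 2 ∂μ ≠ ⊤) : MemLp v 2 μ := by
  refine ⟨hv, ?_⟩
  rw [eLpNorm_lt_top_iff_lintegral_rpow_enorm_lt_top (by norm_num) (by norm_num)]
  simpa using h.lt_top

theorem sq_lintegral_mul_le {α : Type*} [MeasurableSpace α] {μ : Measure α} {F G : α → ℝ≥0∞}
    (hF : AEMeasurable F μ) (hG : AEMeasurable G μ) :
    (∫⁻ x, F x * G x ∂μ) ^ 2 ≤ (∫⁻ x, F x ^ 2 ∂μ) * ∫⁻ x, G x ^ 2 ∂μ := by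
  have h := ENNReal.lintegral_mul_le_Lp_mul_Lq μ Real.HolderConjugate.two_two hF hG
  simp only [Pi.mul_apply] at h
  calc (∫⁻ x, F x * G x ∂μ) ^ 2 ≤ _ := pow_le_pow_left' h 2
    _ = _ := by
      rw [mul_pow, ← ENNReal.rpow_natCast, ← ENNReal.rpow_mul, ← ENNReal.rpow_natCast,
        ← ENNReal.rpow_mul]
      norm_num

theorem memLp_secondDividedDiff_primitive {v : ℝ → ℝ} (hv : MemLp v 2) :
    MemLp (fun p : ℝ × ℝ => secondDividedDiff (primitive v) p.1 p.2) 2 halfPlaneMeasure := by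
  refine memLp_two_of_lintegral_sq_ne_top (measurable_secondDividedDiff
    (continuous_primitive (hv.locallyIntegrable (by norm_num)))).aestronglyMeasurable ?_
  exact ne_top_of_le_ne_top (ENNReal.mul_ne_top (by simp) (lintegral_sq_enorm_ne_top hv))
    (lintegral_sq_secondDividedDiff_primitive_le hv)

/-- `u` represents the functional `v ↦ ∫ α Δ₂(∫ v) dx dh / h` on `L²`. -/
theorem exists_memLp_representing {α : ℝ × ℝ → ℝ} (hα : MemLp α 2 halfPlaneMeasure) :
    ∃ u : ℝ → ℝ, MemLp u 2 ∧ ∀ v : ℝ → ℝ, MemLp v 2 →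
      ∫ x, u x * v x =
        ∫ p, α p * secondDividedDiff (primitive v) p.1 p.2 ∂halfPlaneMeasure := by
  have hint : ∀ v : ℝ → ℝ, MemLp v 2 → Integrable
      (fun p : ℝ × ℝ => α p * secondDividedDiff (primitive v) p.1 p.2) halfPlaneMeasure :=
    fun v hv => hα.integrable_mul (memLp_secondDividedDiff_primitive hv)
  -- Primitives depend only on almost everywhere classes, so the functional is well defined on `L²`.
  have hcongr : ∀ v w : ℝ → ℝ, v =ᵐ[volume] w → primitive v = primitive w := fun v w h =>
    funext fun x => intervalIntegral.integral_congr_ae (h.mono fun t ht _ => ht)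
  have hII : ∀ v : Lp ℝ 2 (volume : Measure ℝ), ∀ x y, IntervalIntegrable v volume x y :=
    fun v x y => (((Lp.memLp v).locallyIntegrable (by norm_num)).integrableOn_isCompact
      isCompact_uIcc).intervalIntegrable
  let L : Lp ℝ 2 (volume : Measure ℝ) →ₗ[ℝ] ℝ :=
    { toFun := fun v => ∫ p, α p * secondDividedDiff (primitive v) p.1 p.2 ∂halfPlaneMeasure
      map_add' := fun v w => by
        have : primitive (v + w : Lp ℝ 2 (volume : Measure ℝ)) =
            fun x => primitive v x + primitive w x := by
          rw [hcongr _ _ (Lp.coeFn_add v w)]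
          exact funext fun x => intervalIntegral.integral_add (hII v 0 x) (hII w 0 x)
        rw [← integral_add (hint v (Lp.memLp v)) (hint w (Lp.memLp w)), this]
        refine integral_congr_ae (Filter.Eventually.of_forall fun p => ?_)
        simp only [secondDividedDiff]
        ring
      map_smul' := fun c v => by
        have : primitive (c • v : Lp ℝ 2 (volume : Measure ℝ)) = fun x => c * primitive v x := by
          rw [hcongr _ _ (Lp.coeFn_smul c v)]
          exact funext fun x => intervalIntegral.integral_const_mul c v
        rw [RingHom.id_apply, smul_eq_mul, ← integral_const_mul, this]
        refine integral_congr_ae (Filter.Eventually.of_forall fun p => ?_)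
        simp only [secondDividedDiff]
        ring }
  set A := ∫⁻ p, ‖α p‖ₑ ^ 2 ∂halfPlaneMeasure with hA
  have hAtop : A ≠ ⊤ := lintegral_sq_enorm_ne_top hα
  -- Cauchy–Schwarz and the square function estimate bound the functional, with the factor `4`
  -- coming from the latter.
  have hbound : ∀ v, ‖L v‖ ≤ Real.sqrt (4 * A.toReal) * ‖v‖ := by
    intro v
    have hv := Lp.memLp v
    have h1 : ENNReal.ofReal (‖L v‖ ^ 2) ≤ A * (4 * ∫⁻ t, ‖v t‖ₑ ^ 2) := by
      rw [ENNReal.ofReal_pow (norm_nonneg _), ofReal_norm]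
      refine (pow_le_pow_left' (enorm_integral_le_lintegral_enorm _) 2).trans ?_
      simp only [enorm_mul]
      refine (sq_lintegral_mul_le hα.1.enorm (memLp_secondDividedDiff_primitive hv).1.enorm).trans ?_
      gcongr
      exact lintegral_sq_secondDividedDiff_primitive_le hv
    have h2 : ∫⁻ t, ‖v t‖ₑ ^ 2 = ENNReal.ofReal (‖v‖ ^ 2) := by
      rw [ENNReal.ofReal_pow (norm_nonneg _), ofReal_norm, Lp.enorm_def,
        eLpNorm_eq_lintegral_rpow_enorm_toReal (by norm_num) (by norm_num),
        ← ENNReal.rpow_natCast, ← ENNReal.rpow_mul]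
      norm_num
    rw [h2, ← ENNReal.ofReal_toReal hAtop, show (4 : ℝ≥0∞) = ENNReal.ofReal 4 by simp,
      ← ENNReal.ofReal_mul (by norm_num), ← ENNReal.ofReal_mul (by positivity),
      ENNReal.ofReal_le_ofReal_iff (by positivity)] at h1
    refine abs_le_of_sq_le_sq' ?_ (by positivity) |>.2
    rw [mul_pow, Real.sq_sqrt (by positivity)]
    linarith
  let L' : StrongDual ℝ (Lp ℝ 2 (volume : Measure ℝ)) := L.mkContinuous _ hbound
  let u := (InnerProductSpace.toDual ℝ (Lp ℝ 2 (volume : Measure ℝ))).symm L'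
  refine ⟨u, Lp.memLp u, fun v hv => ?_⟩
  have h1 : inner ℝ u (hv.toLp v) = L (hv.toLp v) :=
    InnerProductSpace.toDual_symm_apply
  rw [L2.inner_def] at h1
  have h2 : L (hv.toLp v) =
      ∫ p, α p * secondDividedDiff (primitive v) p.1 p.2 ∂halfPlaneMeasure := by
    change ∫ p, α p * secondDividedDiff (primitive (hv.toLp v)) p.1 p.2 ∂halfPlaneMeasure = _
    rw [hcongr _ _ hv.coeFn_toLp]
  rw [← h2, ← h1]
  refine integral_congr_ae ?_
  filter_upwards [hv.coeFn_toLp] with x hx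
  rw [hx]
  simp [mul_comm]

/-! ### Carleson measures, atoms and `BMO` -/

theorem lintegral_enorm_secondDividedDiff_le {W : ℝ → ℝ} (hW : Measurable W) {h : ℝ} (hh : 0 < h) :
    ∫⁻ y, ‖secondDividedDiff W y h‖ₑ ≤ 4 * (ENNReal.ofReal h)⁻¹ * ∫⁻ y, ‖W y‖ₑ := by
  have e1 : ∫⁻ y, ‖W (y + h)‖ₑ = ∫⁻ y, ‖W y‖ₑ := lintegral_add_right_eq_self (fun y => ‖W y‖ₑ) h
  have e2 : ∫⁻ y, ‖W (y - h)‖ₑ = ∫⁻ y, ‖W y‖ₑ := lintegral_sub_right_eq_self (fun y => ‖W y‖ₑ) h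
  calc ∫⁻ y, ‖secondDividedDiff W y h‖ₑ
      ≤ ∫⁻ y, (ENNReal.ofReal h)⁻¹ * (‖W (y + h)‖ₑ + 2 * ‖W y‖ₑ + ‖W (y - h)‖ₑ) := by
        refine lintegral_mono fun y => ?_
        unfold secondDividedDiff
        rw [div_eq_mul_inv, enorm_mul, mul_comm, Real.enorm_of_nonneg (inv_nonneg.2 hh.le),
          ENNReal.ofReal_inv_of_pos hh]
        gcongr
        refine (enorm_add_le _ _).trans ?_
        gcongr
        refine (enorm_sub_le).trans ?_
        rw [enorm_mul, Real.enorm_of_nonneg zero_le_two]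
        simp
    _ = _ := by
        rw [lintegral_const_mul _ (by fun_prop), lintegral_add_left (by fun_prop),
          lintegral_add_left (by fun_prop), lintegral_const_mul _ (by fun_prop), e1, e2]
        ring

theorem setLIntegral_Ioi_inv_mul_inv {l : ℝ} (hl : 0 < l) :
    ∫⁻ h in Ioi l, (ENNReal.ofReal h)⁻¹ * (ENNReal.ofReal h)⁻¹ = (ENNReal.ofReal l)⁻¹ := by
  have h1 : ∫⁻ h in Ioi l, (ENNReal.ofReal h)⁻¹ * (ENNReal.ofReal h)⁻¹ =
      ∫⁻ h in Ioi l, ENNReal.ofReal (h ^ (-2 : ℝ)) := by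
    refine setLIntegral_congr_fun measurableSet_Ioi fun h hh => ?_
    have h0 : 0 < h := hl.trans hh
    rw [← ENNReal.ofReal_inv_of_pos h0, ← ENNReal.ofReal_mul (by positivity), Real.rpow_neg h0.le]
    norm_num [sq]
  rw [h1, ← ofReal_integral_eq_lintegral_ofReal
    (integrableOn_Ioi_rpow_of_lt (by norm_num) hl), integral_Ioi_rpow_of_lt (by norm_num) hl,
    ← ENNReal.ofReal_inv_of_pos hl]
  · norm_num [Real.rpow_neg_one]
  · filter_upwards [ae_restrict_mem measurableSet_Ioi] with h hh
    exact Real.rpow_nonneg (hl.trans hh).le _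

section Atom

variable {α : ℝ × ℝ → ℝ} {M : ℝ} {C : ℝ≥0∞} {v : ℝ → ℝ} {a b : ℝ}

/-- The primitive of a function with vanishing integral supported in `[a, b]`, normalised to be
supported in `[a, b]`. -/
theorem primitive_sub_eq_zero (hv : LocallyIntegrable v) (hsupp : ∀ x ∉ Icc a b, v x = 0)
    (hmean : ∫ x in Icc a b, v x = 0) (hab : a < b) {x : ℝ} (hx : x ∉ Icc a b) :
    primitive v x - primitive v a = 0 := by
  rcases lt_or_ge x a with hxa | hxa
  · rw [← neg_sub, primitive_sub hv, neg_eq_zero, intervalIntegral.integral_of_le hxa.le,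
      integral_Ioc_eq_integral_Ioo]
    exact setIntegral_eq_zero_of_forall_eq_zero fun t ht => hsupp t fun h => not_lt.2 h.1 ht.2
  · have hxb : b < x := not_le.1 fun h => hx ⟨hxa, h⟩
    have hi : ∀ s t, IntervalIntegrable v volume s t := fun s t =>
      (hv.integrableOn_isCompact isCompact_uIcc).intervalIntegrable
    rw [primitive_sub hv, ← intervalIntegral.integral_add_adjacent_intervals (hi a b) (hi b x),
      intervalIntegral.integral_of_le hab.le, ← integral_Icc_eq_integral_Ioc, hmean, zero_add,
      intervalIntegral.integral_of_le hxb.le]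
    exact setIntegral_eq_zero_of_forall_eq_zero fun t ht => hsupp t fun h => not_lt.2 h.2 ht.1

/-- The vanishing mean confines the primitive to `[a, b]`, where it is bounded by the `L¹` norm of
`v`. -/
theorem lintegral_enorm_primitive_sub_le (hv : LocallyIntegrable v)
    (hsupp : ∀ x ∉ Icc a b, v x = 0) (hmean : ∫ x in Icc a b, v x = 0) (hab : a < b) :
    ∫⁻ x, ‖primitive v x - primitive v a‖ₑ ≤ ENNReal.ofReal (b - a) * ∫⁻ t, ‖v t‖ₑ := by
  calc ∫⁻ x, ‖primitive v x - primitive v a‖ₑ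
      ≤ ∫⁻ x, (Icc a b).indicator (fun _ => ∫⁻ t, ‖v t‖ₑ) x := by
        refine lintegral_mono fun x => ?_
        by_cases hx : x ∈ Icc a b
        · rw [indicator_of_mem hx, primitive_sub hv]
          exact (enorm_intervalIntegral_le v hx.1).trans (setLIntegral_le_lintegral _ _)
        · rw [primitive_sub_eq_zero hv hsupp hmean hab hx]
          simp
    _ = _ := by
        rw [lintegral_indicator measurableSet_Icc, setLIntegral_const, Real.volume_Icc, mul_comm]

/-- A Carleson measure condition on a bounded coefficient function `α` bounds its pairing with the
second divided differences of an atom. -/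
theorem sq_lintegral_mul_secondDividedDiff_le (hα : Measurable α)
    (hM : ∀ p, |α p| ≤ M)
    (hC : ∀ a b : ℝ, a < b → ∫⁻ p in Icc a b ×ˢ Ioc 0 (b - a), ‖α p‖ₑ ^ 2 ∂halfPlaneMeasure ≤
      C * ENNReal.ofReal (b - a))
    (hv : MemLp v 2) (hsupp : ∀ x ∉ Icc a b, v x = 0) (hmean : ∫ x in Icc a b, v x = 0)
    (hab : a < b) :
    (∫⁻ p, ‖α p‖ₑ * ‖secondDividedDiff (primitive v) p.1 p.2‖ₑ ∂halfPlaneMeasure) ^ 2 ≤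
      (24 * C + 32 * ENNReal.ofReal M ^ 2) * ENNReal.ofReal (b - a) * ∫⁻ t, ‖v t‖ₑ ^ 2 := by
  have hloc : LocallyIntegrable v := hv.locallyIntegrable (by norm_num)
  set l := b - a with hl
  have hl0 : 0 < l := sub_pos.2 hab
  set E := ∫⁻ t, ‖v t‖ₑ ^ 2 with hE
  set D := ∫⁻ t, ‖v t‖ₑ with hD
  set W : ℝ → ℝ := fun x => primitive v x - primitive v a with hW
  have hWm : Measurable W := ((continuous_primitive hloc).sub continuous_const).measurable
  have hWz : ∀ x ∉ Icc a b, W x = 0 := fun x hx => primitive_sub_eq_zero hloc hsupp hmean hab hx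
  have hVW : ∀ x h, secondDividedDiff (primitive v) x h = secondDividedDiff W x h := by
    intro x h
    simp only [secondDividedDiff, hW]
    ring
  set S := fun p : ℝ × ℝ => ‖secondDividedDiff (primitive v) p.1 p.2‖ₑ with hS
  have hSm : Measurable S := (measurable_secondDividedDiff (continuous_primitive hloc)).enorm
  have hDE : D ^ 2 ≤ ENNReal.ofReal l * E := by
    have e : D = ∫⁻ t in Icc a b, ‖v t‖ₑ := by
      rw [hD, ← lintegral_indicator measurableSet_Icc]
      refine lintegral_congr fun t => ?_
      by_cases ht : t ∈ Icc a b <;> simp [ht, hsupp]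
    rw [e]
    refine (sq_lintegral_le_measure_mul hv.1.enorm.restrict).trans ?_
    rw [Measure.restrict_apply_univ, Real.volume_Icc]
    gcongr
    exact setLIntegral_le_lintegral _ _
  -- The Carleson box over the triple interval. Inside it Cauchy–Schwarz combines the Carleson
  -- condition with the square function estimate; outside it only boundedness of `α` is used.
  set box := Icc (a - l) (b + l) ×ˢ Ioc 0 (b + l - (a - l)) with hbox
  have hboxm : MeasurableSet box := measurableSet_Icc.prod measurableSet_Ioc
  have hnear : (∫⁻ p in box, ‖α p‖ₑ * S p ∂halfPlaneMeasure) ^ 2 ≤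
      12 * C * ENNReal.ofReal l * E := by
    refine (sq_lintegral_mul_le hα.enorm.aemeasurable hSm.aemeasurable).trans ?_
    calc _ ≤ (C * ENNReal.ofReal (b + l - (a - l))) * (4 * E) := by
          refine mul_le_mul' (hC _ _ (by linarith)) ?_
          exact (setLIntegral_le_lintegral _ _).trans
            (lintegral_sq_secondDividedDiff_primitive_le hv)
      _ = _ := by
          rw [show b + l - (a - l) = 3 * l by rw [hl]; ring, ENNReal.ofReal_mul (by norm_num),
            show ENNReal.ofReal 3 = 3 by simp]
          ring
  -- Only scales `h > l` contribute off the box. There `‖Δ₂W(·,h)‖₁ ≤ 4‖W‖₁/h ≤ 4lD/h`, and the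
  -- integral of `1/h²` over `h > l` is `1/l`, which cancels `l`.
  have hfar : ∫⁻ p in boxᶜ, ‖α p‖ₑ * S p ∂halfPlaneMeasure ≤ 4 * ENNReal.ofReal M * D := by
    rw [← lintegral_indicator hboxm.compl,
      lintegral_halfPlaneMeasure (Measurable.indicator (by fun_prop) hboxm.compl)]
    calc _ ≤ ∫⁻ h in Ioi 0, (Ioi l).indicator (fun h => (ENNReal.ofReal h)⁻¹ *
          (ENNReal.ofReal h)⁻¹ * (4 * ENNReal.ofReal M * (ENNReal.ofReal l * D))) h := by
          refine setLIntegral_mono ((by fun_prop : Measurable _).indicator measurableSet_Ioi)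
            fun h hh => ?_
          have hh0 : 0 < h := hh
          by_cases hhl : l < h
          · rw [indicator_of_mem (show h ∈ Ioi l from hhl)]
            calc _ ≤ (ENNReal.ofReal h)⁻¹ *
                  ∫⁻ x, ENNReal.ofReal M * ‖secondDividedDiff W x h‖ₑ := by
                  gcongr with x
                  refine (indicator_le_self _ _ _).trans ?_
                  simp only [hS, hVW]
                  gcongr
                  rw [← ofReal_norm]
                  exact ENNReal.ofReal_le_ofReal (hM _)
              _ ≤ (ENNReal.ofReal h)⁻¹ * (ENNReal.ofReal M *
                  (4 * (ENNReal.ofReal h)⁻¹ * (ENNReal.ofReal l * D))) := by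
                  rw [lintegral_const_mul' _ _ ENNReal.ofReal_ne_top]
                  gcongr
                  refine (lintegral_enorm_secondDividedDiff_le hWm hh0).trans ?_
                  gcongr
                  exact lintegral_enorm_primitive_sub_le hloc hsupp hmean hab
              _ = _ := by ring
          · rw [indicator_of_notMem (show h ∉ Ioi l from hhl)]
            have hhl' : h ≤ l := not_lt.1 hhl
            -- For `h ≤ l`, a point off the box has `x` at distance more than `l` from `[a, b]`, so
            -- `W` vanishes at `x` and `x ± h`.
            have hz : ∀ x, (boxᶜ).indicator (fun p => ‖α p‖ₑ * S p) (x, h) = 0 := by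
              intro x
              refine indicator_apply_eq_zero.2 fun hx => ?_
              have hx' : x ∉ Icc (a - l) (b + l) := fun hxI =>
                hx ⟨hxI, hh0, by simp only; linarith⟩
              have hw : ∀ z, |z - x| ≤ l → W z = 0 := fun z hz => hWz z fun hzI =>
                hx' ⟨by linarith [(abs_le.1 hz).2, hzI.1], by linarith [(abs_le.1 hz).1, hzI.2]⟩
              change ‖α (x, h)‖ₑ * ‖secondDividedDiff (primitive v) x h‖ₑ = 0
              rw [hVW, secondDividedDiff, hw (x + h) (by rw [add_sub_cancel_left, abs_of_pos hh0]; exact hhl'),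
                hw x (by simpa using hl0.le),
                hw (x - h) (by rw [sub_sub_cancel_left, abs_neg, abs_of_pos hh0]; exact hhl')]
              simp
            simp [hz]
      _ ≤ ∫⁻ h in Ioi l, (ENNReal.ofReal h)⁻¹ *
          (ENNReal.ofReal h)⁻¹ * (4 * ENNReal.ofReal M * (ENNReal.ofReal l * D)) :=
          (setLIntegral_le_lintegral _ _).trans_eq (lintegral_indicator measurableSet_Ioi _)
      _ = _ := by
          rw [lintegral_mul_const _ (by fun_prop), setLIntegral_Ioi_inv_mul_inv hl0]
          calc _ = (ENNReal.ofReal l)⁻¹ * ENNReal.ofReal l * (4 * ENNReal.ofReal M * D) := by ring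
            _ = _ := by rw [ENNReal.inv_mul_cancel (by simpa using hl0) (by simp), one_mul]
  rw [← lintegral_add_compl _ hboxm]
  have hsq : ∀ x y : ℝ≥0∞, (x + y) ^ 2 ≤ 2 * x ^ 2 + 2 * y ^ 2 := by
    intro x y
    have := ENNReal.rpow_add_le_mul_rpow_add_rpow x y (p := 2) (by norm_num)
    norm_num at this
    rwa [mul_add] at this
  calc _ ≤ _ := hsq _ _
    _ ≤ 2 * (12 * C * ENNReal.ofReal l * E) +
        2 * (16 * ENNReal.ofReal M ^ 2 * (ENNReal.ofReal l * E)) := by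
        gcongr
        calc _ ≤ (4 * ENNReal.ofReal M * D) ^ 2 := by gcongr
          _ = 16 * ENNReal.ofReal M ^ 2 * D ^ 2 := by ring
          _ ≤ _ := by gcongr
    _ = _ := by ring

end Atom

/-- A function of `L²` whose pairing with atoms is that of a Carleson measure is in `BMO`. -/
theorem mem_BMO_of_representing {α : ℝ × ℝ → ℝ} {M : ℝ} {C : ℝ≥0∞} (hα : Measurable α)
    (hM : ∀ p, |α p| ≤ M) (hCtop : C ≠ ⊤)
    (hC : ∀ a b : ℝ, a < b → ∫⁻ p in Icc a b ×ˢ Ioc 0 (b - a), ‖α p‖ₑ ^ 2 ∂halfPlaneMeasure ≤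
      C * ENNReal.ofReal (b - a))
    {u : ℝ → ℝ} (hu : MemLp u 2) (hrep : ∀ v : ℝ → ℝ, MemLp v 2 → ∫ x, u x * v x =
      ∫ p, α p * secondDividedDiff (primitive v) p.1 p.2 ∂halfPlaneMeasure) :
    u ∈ BMO := by
  have huloc : LocallyIntegrable u := hu.locallyIntegrable (by norm_num)
  set K := 24 * C + 32 * ENNReal.ofReal M ^ 2 with hK
  have hKtop : K ≠ ⊤ := ENNReal.add_ne_top.2
    ⟨ENNReal.mul_ne_top (by simp) hCtop, ENNReal.mul_ne_top (by simp) (by simp)⟩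
  refine ⟨huloc, lt_of_le_of_lt (iSup_le fun a => iSup_le fun b => iSup_le fun hab => ?_)
    (ENNReal.rpow_lt_top_of_nonneg (by norm_num : (0 : ℝ) ≤ 1 / 2) hKtop)⟩
  refine ENNReal.rpow_le_rpow ?_ (by norm_num)
  refine ENNReal.div_le_of_le_mul ?_
  set m := ⨍ y in Icc a b, u y with hm
  -- Duality test: `u` is paired with its own oscillation on `[a, b]`, an unnormalised atom.
  set v : ℝ → ℝ := (Icc a b).indicator fun x => u x - m with hv
  have hv2 : MemLp v 2 := by
    have h1 : MemLp (fun x => u x - m) 2 (volume.restrict (Icc a b)) :=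
      (hu.restrict _).sub (memLp_const m)
    exact (memLp_indicator_iff_restrict measurableSet_Icc).2 h1
  have hv1 : Integrable v := by
    rw [hv, integrable_indicator_iff measurableSet_Icc]
    exact (huloc.integrableOn_isCompact isCompact_Icc).sub (by simp)
  have hsupp : ∀ x ∉ Icc a b, v x = 0 := fun x hx => indicator_of_notMem hx _
  have hvI : ∫ x in Icc a b, v x = 0 := by
    rw [← integral_sub_average (volume.restrict (Icc a b)) u]
    exact setIntegral_congr_fun measurableSet_Icc fun x hx => indicator_of_mem hx _
  have hmean : ∫ x, v x = 0 := by
    rw [← hvI]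
    exact (setIntegral_eq_integral_of_forall_compl_eq_zero hsupp).symm
  have hE : ∫⁻ x in Icc a b, ENNReal.ofReal (|u x - m| ^ 2) = ∫⁻ x, ‖v x‖ₑ ^ 2 := by
    rw [← lintegral_indicator measurableSet_Icc]
    refine lintegral_congr fun x => ?_
    by_cases hx : x ∈ Icc a b <;> simp [hv, hx, enorm_sq_eq_ofReal]
  rw [hE]
  set E := ∫⁻ x, ‖v x‖ₑ ^ 2 with hEdef
  have hEtop : E ≠ ⊤ := lintegral_sq_enorm_ne_top hv2
  -- As `v` has mean zero, `u` may be replaced by `u - m` in the pairing.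
  have huv : ∫ x, u x * v x = ∫ x, v x ^ 2 := by
    have h1 : ∀ x, u x * v x = v x ^ 2 + m * v x := by
      intro x
      by_cases hx : x ∈ Icc a b
      · simp only [hv, indicator_of_mem hx]; ring
      · rw [hsupp x hx]; ring
    simp only [h1]
    rw [integral_add hv2.integrable_sq (hv1.const_mul m), integral_const_mul, hmean, mul_zero,
      add_zero]
  have hE2 : E = ENNReal.ofReal (∫ x, v x ^ 2) := by
    rw [ofReal_integral_eq_lintegral_ofReal hv2.integrable_sq
      (Filter.Eventually.of_forall fun x => sq_nonneg _)]
    exact lintegral_congr fun x => enorm_sq_eq_ofReal _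
  have hEle : E ≤ ∫⁻ p, ‖α p‖ₑ * ‖secondDividedDiff (primitive v) p.1 p.2‖ₑ ∂halfPlaneMeasure := by
    rw [hE2, ← huv, hrep v hv2]
    refine (Real.ofReal_le_enorm _).trans ((enorm_integral_le_lintegral_enorm _).trans_eq ?_)
    simp only [enorm_mul]
  -- The atom estimate is quadratic in the pairing but linear in `E`, so one factor `E`, finite and
  -- nonzero, cancels.
  have hsq : E * E ≤ K * ENNReal.ofReal (b - a) * E := by
    rw [← sq]
    exact (pow_le_pow_left' hEle 2).trans
      (sq_lintegral_mul_secondDividedDiff_le hα hM hC hv2 hsupp hvI hab)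
  rcases eq_or_ne E 0 with h0 | h0
  · rw [h0]; exact zero_le
  · exact (ENNReal.mul_le_mul_iff_left h0 hEtop).1 hsq

/-! ### The distributional derivative of a superposition -/

theorem hasDerivAt_primitive {φ : ℝ → ℝ} (hφ : Continuous φ) (x : ℝ) :
    HasDerivAt (primitive φ) (φ x) x :=
  intervalIntegral.integral_hasDerivAt_right (hφ.intervalIntegrable _ _)
    (hφ.stronglyMeasurableAtFilter _ _) hφ.continuousAt

/-- The tent has slope `±1/h²` on its two halves, so one integration by parts leaves the difference
of the integrals of `φ` over the halves. The proof supplies explicit antiderivatives. -/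
theorem integral_tent_sub_mul_deriv {φ : ℝ → ℝ} (hφ : ContDiff ℝ ∞ φ) {h : ℝ} (hh : 0 < h)
    (y : ℝ) :
    ∫ x, tent h (x - y) * deriv φ x = secondDividedDiff (primitive φ) y h / h := by
  have hd : Continuous (deriv φ) := hφ.continuous_deriv (by exact_mod_cast le_top)
  have hφd : ∀ x, HasDerivAt φ (deriv φ x) x := fun x =>
    (hφ.differentiable (by simp)).differentiableAt.hasDerivAt
  have hΦd := hasDerivAt_primitive hφ.continuous
  have hc : Continuous fun x => tent h (x - y) * deriv φ x :=
    ((continuous_tent h).comp (continuous_sub_right y)).mul hd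
  have h1 : ∫ x, tent h (x - y) * deriv φ x =
      ∫ x in (y - h)..(y + h), tent h (x - y) * deriv φ x := by
    rw [intervalIntegral.integral_of_le (by linarith),
      setIntegral_eq_integral_of_forall_compl_eq_zero]
    intro x hx
    rw [tent_eq_zero hh, zero_mul]
    by_contra hlt
    have := abs_lt.1 (not_le.1 hlt)
    exact hx ⟨by linarith [this.1], by linarith [this.2]⟩
  have hR : ∫ x in y..(y + h), tent h (x - y) * deriv φ x =
      ((h - (y + h - y)) * φ (y + h) + primitive φ (y + h)) / h ^ 2 -
        ((h - (y - y)) * φ y + primitive φ y) / h ^ 2 := by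
    refine intervalIntegral.integral_eq_sub_of_hasDerivAt
      (f := fun x => ((h - (x - y)) * φ x + primitive φ x) / h ^ 2) (fun x hx => ?_)
      (hc.intervalIntegrable _ _)
    rw [uIcc_of_le (by linarith)] at hx
    have := ((((((hasDerivAt_id x).sub_const y).const_sub h).mul (hφd x)).add
      (hΦd x)).div_const (h ^ 2))
    convert! this using 1
    unfold tent
    rw [abs_of_nonneg (by linarith [hx.1]), abs_of_nonneg (by linarith [hx.1] : 0 ≤ x - y),
      abs_of_nonpos (by linarith [hx.2])]
    simp only [id]
    field_simp
    ring
  have hL : ∫ x in (y - h)..y, tent h (x - y) * deriv φ x =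
      ((h + (y - y)) * φ y - primitive φ y) / h ^ 2 -
        ((h + (y - h - y)) * φ (y - h) - primitive φ (y - h)) / h ^ 2 := by
    refine intervalIntegral.integral_eq_sub_of_hasDerivAt
      (f := fun x => ((h + (x - y)) * φ x - primitive φ x) / h ^ 2) (fun x hx => ?_)
      (hc.intervalIntegrable _ _)
    rw [uIcc_of_le (by linarith)] at hx
    have := ((((((hasDerivAt_id x).sub_const y).const_add h).mul (hφd x)).sub
      (hΦd x)).div_const (h ^ 2))
    convert! this using 1
    unfold tent
    rw [abs_of_nonneg (by linarith [hx.1]), abs_of_nonpos (by linarith [hx.2] : x - y ≤ 0),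
      abs_of_nonpos (by linarith [hx.2])]
    simp only [id]
    field_simp
    ring
  rw [h1, ← intervalIntegral.integral_add_adjacent_intervals (hc.intervalIntegrable _ y)
    (hc.intervalIntegrable y _), hL, hR]
  unfold secondDividedDiff
  field_simp
  ring

theorem integral_scaleMeasure (F : ℝ → ℝ) :
    ∫ h, F h ∂scaleMeasure = ∫ h in Ioi 0, F h / h := by
  unfold scaleMeasure
  rw [integral_withDensity_eq_integral_toReal_smul (by fun_prop)]
  · refine setIntegral_congr_fun measurableSet_Ioi fun h hh => ?_
    have hh0 : 0 < h := hh
    simp only [ENNReal.toReal_inv, ENNReal.toReal_ofReal hh0.le, smul_eq_mul]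
    rw [div_eq_mul_inv, mul_comm]
  · filter_upwards [ae_restrict_mem measurableSet_Ioi] with h hh
    simpa using hh

theorem integral_tentAverage_mul_deriv {b φ : ℝ → ℝ} {B : ℝ} (hb : Measurable b)
    (hB : ∀ y, |b y| ≤ B) (hφ : ContDiff ℝ ∞ φ) (hφc : HasCompactSupport φ) {h : ℝ} (hh : 0 < h) :
    ∫ x, tentAverage h b x * deriv φ x =
      ∫ y, b y * secondDividedDiff (primitive φ) y h / h := by
  have hd : Continuous (deriv φ) := hφ.continuous_deriv (by exact_mod_cast le_top)
  have hdi : Integrable (deriv φ) := hd.integrable_of_hasCompactSupport hφc.deriv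
  have hint : Integrable (Function.uncurry fun x y => tent h (x - y) * b y * deriv φ x)
      (volume.prod volume) := by
    have h1 : Integrable (fun p : ℝ × ℝ => deriv φ p.1 * tent h p.2) (volume.prod volume) :=
      hdi.mul_prod (integrable_tent hh)
    have h2 : Integrable (fun p : ℝ × ℝ => deriv φ p.1 * tent h (p.1 - p.2))
        (volume.prod volume) := by
      have h3 := (measurePreserving_prod_sub (volume : Measure ℝ) (volume : Measure ℝ)).integrable_comp
        h1.1 |>.2 h1
      refine h3.congr (Filter.Eventually.of_forall fun p => ?_)
      simp only [Function.comp]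
      rw [← tent_neg, neg_sub]
    refine (h2.mul_bdd (g := fun p => b p.2) (c := B)
      (hb.comp measurable_snd).aestronglyMeasurable
      (Filter.Eventually.of_forall fun p => hB p.2)).congr
      (Filter.Eventually.of_forall fun p => ?_)
    simp only [Function.uncurry]
    ring
  calc ∫ x, tentAverage h b x * deriv φ x
      = ∫ x, ∫ y, tent h (x - y) * b y * deriv φ x := by
        simp only [tentAverage, integral_mul_const]
    _ = ∫ y, ∫ x, tent h (x - y) * b y * deriv φ x := integral_integral_swap hint
    _ = _ := by
        congr 1
        ext y
        rw [mul_div_assoc, ← integral_tent_sub_mul_deriv hφ hh, ← integral_const_mul]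
        congr 1
        ext x
        ring

/-- Fubini moves each tent onto `φ'`, and the resulting factor `1/h` is the density of the
half-plane measure. The right side is the functional to which the Riesz representation applies. -/
theorem integral_tentSynthesis_mul_deriv {a : ℝ × ℝ → ℝ} {B H : ℝ} {φ : ℝ → ℝ} (ha : Measurable a)
    (hB : ∀ x h, 0 < h → |a (x, h)| ≤ B)
    (hα : MemLp ({p : ℝ × ℝ | p.2 ≤ H}.indicator a) 2 halfPlaneMeasure)
    (hφ : ContDiff ℝ ∞ φ) (hφc : HasCompactSupport φ) :
    ∫ x, tentSynthesis H a x * deriv φ x =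
      ∫ p, {p : ℝ × ℝ | p.2 ≤ H}.indicator a p *
        secondDividedDiff (primitive φ) p.1 p.2 ∂halfPlaneMeasure := by
  have hd : Continuous (deriv φ) := hφ.continuous_deriv (by exact_mod_cast le_top)
  have hdi : Integrable (deriv φ) := hd.integrable_of_hasCompactSupport hφc.deriv
  have hφ2 : MemLp φ 2 := hφ.continuous.memLp_of_hasCompactSupport hφc
  have hint : Integrable (Function.uncurry fun x h =>
      tentAverage h (fun y => a (y, h)) x * deriv φ x)
      (volume.prod (volume.restrict (Ioc 0 H))) := by
    have h1 : Integrable (fun p : ℝ × ℝ => deriv φ p.1 * B)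
        (volume.prod (volume.restrict (Ioc 0 H))) :=
      hdi.mul_prod (integrable_const B)
    refine h1.mono ?_ ?_
    · refine Measurable.aestronglyMeasurable ?_
      exact ((stronglyMeasurable_tentAverage ha).measurable.comp measurable_swap).mul
        (hd.measurable.comp measurable_fst)
    · have : ∀ᵐ p : ℝ × ℝ ∂(volume.prod (volume.restrict (Ioc 0 H))), p.2 ∈ Ioc 0 H :=
        Measure.quasiMeasurePreserving_snd.ae (ae_restrict_mem measurableSet_Ioc)
      filter_upwards [this] with p hp
      simp only [Function.uncurry, norm_mul]
      rw [mul_comm]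
      gcongr
      exact (abs_tentAverage_le (fun y => hB y p.2 hp.1) hp.1 p.1).trans (le_abs_self B)
  calc ∫ x, tentSynthesis H a x * deriv φ x
      = ∫ x, ∫ h in Ioc 0 H, tentAverage h (fun y => a (y, h)) x * deriv φ x := by
        simp only [tentSynthesis, integral_mul_const]
    _ = ∫ h in Ioc 0 H, ∫ x, tentAverage h (fun y => a (y, h)) x * deriv φ x :=
        integral_integral_swap hint
    _ = ∫ h in Ioc 0 H, ∫ y, a (y, h) * secondDividedDiff (primitive φ) y h / h := by
        refine setIntegral_congr_fun measurableSet_Ioc fun h hh => ?_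
        exact integral_tentAverage_mul_deriv (by fun_prop) (fun y => hB y h hh.1) hφ hφc hh.1
    _ = ∫ h in Ioi 0, (∫ y, {p : ℝ × ℝ | p.2 ≤ H}.indicator a (y, h) *
          secondDividedDiff (primitive φ) y h) / h := by
        have e : Ioc 0 H = Ioi 0 ∩ Iic H := rfl
        rw [e, ← setIntegral_indicator measurableSet_Iic]
        refine setIntegral_congr_fun measurableSet_Ioi fun h hh => ?_
        by_cases hhH : h ≤ H
        · simp only [indicator_of_mem (show h ∈ Iic H from hhH), integral_div]
          congr 2
          ext y
          rw [indicator_of_mem (show (y, h) ∈ {p : ℝ × ℝ | p.2 ≤ H} from hhH)]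
        · have : ∀ y, {p : ℝ × ℝ | p.2 ≤ H}.indicator a (y, h) = 0 := fun y =>
            indicator_of_notMem (show (y, h) ∉ {p : ℝ × ℝ | p.2 ≤ H} from hhH) _
          simp only [indicator_of_notMem (show h ∉ Iic H from hhH), this, zero_mul, integral_zero,
            zero_div]
    _ = _ := by
        have hi : Integrable (fun p : ℝ × ℝ => {p : ℝ × ℝ | p.2 ≤ H}.indicator a p *
            secondDividedDiff (primitive φ) p.1 p.2) halfPlaneMeasure :=
          hα.integrable_mul (memLp_secondDividedDiff_primitive hφ2)
        unfold halfPlaneMeasure at hi ⊢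
        rw [integral_prod_symm _ hi, integral_scaleMeasure]

/-! ### Sufficiency: splitting the reproducing formula -/

theorem zygmundSeminorm_le_ofReal {f : ℝ → ℝ} {K : ℝ}
    (h : ∀ x r, 0 < r → |secondDividedDiff f x r| ≤ K) : zygmundSeminorm f ≤ ENNReal.ofReal K :=
  iSup_le fun x => iSup_le fun r => iSup_le fun hr => ENNReal.ofReal_le_ofReal (h x r hr)

theorem abs_secondDividedDiff_le_toReal {f : ℝ → ℝ} (hf : zygmundSeminorm f < ⊤) (x : ℝ) {h : ℝ}
    (hh : 0 < h) : |secondDividedDiff f x h| ≤ (zygmundSeminorm f).toReal :=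
  (ENNReal.ofReal_le_iff_le_toReal hf.ne).1 (ofReal_abs_secondDividedDiff_le f x hh)

theorem halfPlaneMeasure_zygmundLargeSet_le {f : ℝ → ℝ} (hf : Continuous f) {ε C : ℝ}
    (hC : ∀ a b : ℝ, a < b → zygmundDensity f ε a b ≤ ENNReal.ofReal C) {a b : ℝ} (hab : a < b) :
    halfPlaneMeasure (zygmundLargeSet f ε ∩ Icc a b ×ˢ Ioc 0 (b - a)) ≤
      ENNReal.ofReal C * ENNReal.ofReal (b - a) := by
  have := hC a b hab
  rwa [zygmundDensity_eq hf, ENNReal.div_le_iff (by simpa using hab) (by simp)] at this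

/-- For `h ≤ H` the second difference vanishes when `x` is farther than `H` from the support of `f`,
so the strip meets the large set inside a single Carleson box. This puts the truncated coefficients
in `L²`. -/
theorem halfPlaneMeasure_zygmundLargeSet_strip_lt_top {f : ℝ → ℝ} (hf : Continuous f)
    (hfc : HasCompactSupport f) {ε C : ℝ} (hε : 0 < ε)
    (hC : ∀ a b : ℝ, a < b → zygmundDensity f ε a b ≤ ENNReal.ofReal C) (H : ℝ) :
    halfPlaneMeasure (zygmundLargeSet f ε ∩ {p | p.2 ≤ H}) < ⊤ := by
  obtain ⟨R, hR⟩ := hfc.isCompact.isBounded.subset_closedBall 0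
  have hz : ∀ y, R < |y| → f y = 0 := fun y hy => image_eq_zero_of_notMem_tsupport fun h => by
    have := hR h
    rw [Metric.mem_closedBall, dist_zero_right, Real.norm_eq_abs] at this
    linarith
  set T := |R| + |H| + 1 with hT
  have hT0 : 0 < T := by positivity
  refine lt_of_le_of_lt (measure_mono ?_) (lt_of_le_of_lt
    (halfPlaneMeasure_zygmundLargeSet_le hf hC (show -T < T by linarith))
    (ENNReal.mul_lt_top (by simp) (by simp)))
  rintro ⟨x, h⟩ ⟨⟨hh, hlt⟩, hhH⟩
  refine ⟨⟨hh, hlt⟩, ?_, hh, ?_⟩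
  · by_contra hx
    have hxT : T < |x| := not_le.1 fun hle => hx (abs_le.1 hle)
    have hH : h ≤ |H| := le_trans hhH (le_abs_self H)
    have hh0 : 0 < h := hh
    have hR' := le_abs_self R
    have h1 : |x| ≤ |x + h| + h := by
      have := abs_sub (x + h) h
      rwa [add_sub_cancel_right, abs_of_pos hh0] at this
    have h2 : |x| ≤ |x - h| + h := by
      have := abs_add_le (x - h) h
      rwa [sub_add_cancel, abs_of_pos hh0] at this
    have : secondDividedDiff f x h = 0 := by
      unfold secondDividedDiff
      rw [hz _ (by linarith : R < |x + h|), hz _ (by linarith : R < |x - h|),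
        hz x (by linarith)]
      simp
    dsimp only at hlt
    rw [this, abs_zero] at hlt
    exact lt_asymm hε hlt
  · have h1 : h ≤ |H| := le_trans hhH (le_abs_self H)
    have h2 := abs_nonneg R
    dsimp only
    linarith

/-- Superposing tent averages with coefficients supported in a Carleson set gives a primitive of a
`BMO` function. -/
theorem tentSynthesis_mem_IBMO {a : ℝ × ℝ → ℝ} {M H C : ℝ} {A : Set (ℝ × ℝ)} (ha : Measurable a)
    (hM : ∀ x h, 0 < h → |a (x, h)| ≤ M) (hA : MeasurableSet A) (hA0 : ∀ p ∈ A, 0 < p.2)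
    (haA : ∀ p ∉ A, a p = 0)
    (hC : ∀ a b : ℝ, a < b → halfPlaneMeasure (A ∩ Icc a b ×ˢ Ioc 0 (b - a)) ≤
      ENNReal.ofReal C * ENNReal.ofReal (b - a))
    (hAH : halfPlaneMeasure (A ∩ {p | p.2 ≤ H}) < ⊤) :
    tentSynthesis H a ∈ IBMO := by
  have hM0 : 0 ≤ M := (abs_nonneg _).trans (hM 0 1 one_pos)
  have hHm : MeasurableSet {p : ℝ × ℝ | p.2 ≤ H} := measurableSet_le measurable_snd measurable_const
  set α := {p : ℝ × ℝ | p.2 ≤ H}.indicator a with hα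
  have hαm : Measurable α := ha.indicator hHm
  have hαM : ∀ p, |α p| ≤ M := by
    intro p
    by_cases hp : p ∈ A
    · exact (norm_indicator_le_norm_self a p).trans (hM p.1 p.2 (hA0 p hp))
    · rw [hα, indicator_apply_eq_zero.2 fun _ => haA p hp, abs_zero]
      exact hM0
  have hαA : ∀ p ∉ A ∩ {p | p.2 ≤ H}, α p = 0 := by
    intro p hp
    refine indicator_apply_eq_zero.2 fun hpH => haA p fun hpA => hp ⟨hpA, hpH⟩
  have hsq : ∀ p, ‖α p‖ₑ ^ 2 ≤
      (A ∩ {p | p.2 ≤ H}).indicator (fun _ => ENNReal.ofReal (M ^ 2)) p := by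
    intro p
    by_cases hp : p ∈ A ∩ {p | p.2 ≤ H}
    · rw [indicator_of_mem hp, enorm_sq_eq_ofReal, ← sq_abs]
      exact ENNReal.ofReal_le_ofReal (by gcongr; exact hαM p)
    · rw [hαA p hp]
      simp
  have hα2 : MemLp α 2 halfPlaneMeasure := by
    refine memLp_two_of_lintegral_sq_ne_top hαm.aestronglyMeasurable
      (ne_top_of_le_ne_top ?_ (lintegral_mono hsq))
    rw [lintegral_indicator (hA.inter hHm), setLIntegral_const]
    exact ENNReal.mul_ne_top (by simp) hAH.ne
  -- The sign of `-α` matches the minus sign in the definition of the distributional derivative.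
  have hcarl : ∀ s t : ℝ, s < t →
      ∫⁻ p in Icc s t ×ˢ Ioc 0 (t - s), ‖-α p‖ₑ ^ 2 ∂halfPlaneMeasure ≤
        ENNReal.ofReal (M ^ 2) * ENNReal.ofReal C * ENNReal.ofReal (t - s) := by
    intro s t hst
    simp only [enorm_neg]
    calc _ ≤ _ := lintegral_mono hsq
      _ ≤ ENNReal.ofReal (M ^ 2) * halfPlaneMeasure (A ∩ Icc s t ×ˢ Ioc 0 (t - s)) := by
        rw [lintegral_indicator (hA.inter hHm), setLIntegral_const,
          Measure.restrict_apply (hA.inter hHm)]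
        gcongr
        exact inter_subset_left
      _ ≤ _ := by
        rw [mul_assoc]
        gcongr
        exact hC s t hst
  obtain ⟨u, hu, hrep⟩ := exists_memLp_representing hα2.neg
  refine ⟨continuous_tentSynthesis ha hM H, u, ?_, ?_⟩
  · exact mem_BMO_of_representing (M := M) hαm.neg (fun p => by rw [Pi.neg_apply, abs_neg]; exact hαM p)
      (ENNReal.mul_ne_top (by simp) (by simp)) hcarl hu hrep
  · intro φ hφ hφc
    rw [hrep φ (hφ.continuous.memLp_of_hasCompactSupport hφc),
      integral_tentSynthesis_mul_deriv ha hM hα2 hφ hφc, ← integral_neg]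
    simp [hα]

theorem mem_zygmundClosure_of_density_bound {f : ℝ → ℝ} (hf : f ∈ zygmundClass)
    (hfc : HasCompactSupport f) (hdens : ∀ ε : ℝ, 0 < ε → ∃ C : ℝ, 0 < C ∧
      ∀ a b : ℝ, a < b → zygmundDensity f ε a b ≤ ENNReal.ofReal C) :
    f ∈ zygmundClosure IBMO := by
  refine ⟨hf, fun ε hε => ?_⟩
  obtain ⟨hcont, hfin⟩ := hf
  obtain ⟨B, hB⟩ := hfc.exists_bound_of_continuous hcont
  have hB0 : 0 ≤ B := (norm_nonneg _).trans (hB 0)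
  set M := (zygmundSeminorm f).toReal with hMdef
  have hM : ∀ x h, 0 < h → |secondDividedDiff f x h| ≤ M := fun x h hh =>
    abs_secondDividedDiff_le_toReal hfin x hh
  have hM0 : 0 ≤ M := ENNReal.toReal_nonneg
  -- The threshold `ε/32` and the scale `H` below make the fine-scale remainder and the coarse-scale
  -- term at most `ε/4` each: `16 · (1/2) · (ε/32)` and `2 · (4B/H)`. The `1` in `B + 1` keeps `H`
  -- positive.
  obtain ⟨C, -, hC⟩ := hdens (ε / 32) (by positivity)
  set H := 32 * (B + 1) / ε with hH
  have hH0 : 0 < H := by positivity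
  set A := zygmundLargeSet f (ε / 32) with hA
  have hAm : MeasurableSet A := measurableSet_zygmundLargeSet hcont _
  have hlog : 1 / 2 < Real.log 2 := by linarith [Real.log_two_gt_d9]
  -- The coefficient of the superposition once the reproducing formula is divided by `log 2`.
  set c := 1 / (4 * Real.log 2) with hc
  have hc0 : 0 < c := by positivity
  have hc1 : c ≤ 1 / 2 := by
    rw [hc, div_le_div_iff₀ (by positivity) (by positivity)]
    linarith
  set s := fun p : ℝ × ℝ => secondDividedDiff f p.1 p.2 with hs
  have hsm : Measurable s := measurable_secondDividedDiff hcont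
  set a : ℝ × ℝ → ℝ := A.indicator fun p => -c * s p with ha
  have ham : Measurable a := (hsm.const_mul _).indicator hAm
  set d : ℝ × ℝ → ℝ := Aᶜ.indicator fun p => -c * s p with hd
  have hdm : Measurable d := (hsm.const_mul _).indicator hAm.compl
  have haM : ∀ x h, 0 < h → |a (x, h)| ≤ 1 / 2 * M := by
    intro x h hh
    refine (norm_indicator_le_norm_self (fun p => -c * s p) (x, h)).trans ?_
    rw [Real.norm_eq_abs, abs_mul, abs_neg, abs_of_pos hc0]
    exact mul_le_mul hc1 (hM x h hh) (abs_nonneg _) (by norm_num)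
  have hdM : ∀ x h, 0 < h → |d (x, h)| ≤ 1 / 2 * (ε / 32) := by
    intro x h hh
    by_cases hp : (x, h) ∈ A
    · rw [hd, indicator_of_notMem (show (x, h) ∉ Aᶜ from fun hn => hn hp), abs_zero]
      positivity
    · rw [hd, indicator_of_mem (show (x, h) ∈ Aᶜ from hp), abs_mul, abs_neg, abs_of_pos hc0]
      exact mul_le_mul hc1 (not_lt.1 fun hlt => hp ⟨hh, hlt⟩) (abs_nonneg _) (by norm_num)
  have hdecomp : ∀ x, f x = 1 / Real.log 2 * (∫ h in H..2 * H, tentAverage h f x / h) +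
      (tentSynthesis H a x + tentSynthesis H d x) := by
    intro x
    have h1 := log_two_mul_eq hcont hB hM hH0 x
    have h2 : tentSynthesis H a x + tentSynthesis H d x = -c * tentSynthesis H s x := by
      rw [← tentSynthesis_add ham haM hdm hdM]
      have : (fun p => a p + d p) = fun p => -c * s p := by
        ext p
        exact indicator_self_add_compl_apply A _ p
      rw [this]
      unfold tentSynthesis tentAverage
      rw [← integral_const_mul]
      congr 1
      ext h
      rw [← integral_const_mul]
      congr 1
      ext y
      ring
    have hlog0 : Real.log 2 ≠ 0 := by positivity
    rw [h2, hc]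
    field_simp
    linarith
  -- The approximant keeps only the coefficients on the large set.
  refine ⟨tentSynthesis H a, ⟨?_, continuous_tentSynthesis ham haM H, ?_⟩, ?_⟩
  · exact tentSynthesis_mem_IBMO ham haM hAm (fun p hp => hp.1) (fun p hp => indicator_of_notMem hp _)
      (fun s t hst => halfPlaneMeasure_zygmundLargeSet_le hcont hC hst)
      (halfPlaneMeasure_zygmundLargeSet_strip_lt_top hcont hfc (by positivity) hC H)
  · exact (zygmundSeminorm_le_ofReal fun x r hr =>
      abs_secondDividedDiff_tentSynthesis_le ham haM hH0.le x hr).trans_lt ENNReal.ofReal_lt_top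
  · refine (zygmundSeminorm_le_ofReal (K := ε / 2) fun x r hr => ?_).trans_lt
      ((ENNReal.ofReal_lt_ofReal_iff hε).2 (by linarith))
    have e : secondDividedDiff (f - tentSynthesis H a) x r =
        1 / Real.log 2 * secondDividedDiff
          (fun x => ∫ h in H..2 * H, tentAverage h f x / h) x r +
        secondDividedDiff (tentSynthesis H d) x r := by
      simp only [secondDividedDiff, Pi.sub_apply]
      rw [hdecomp (x + r), hdecomp x, hdecomp (x - r)]
      ring
    have h1 := abs_secondDividedDiff_integral_tentAverage_le hcont hB hH0 x hr
    have h2 := abs_secondDividedDiff_tentSynthesis_le hdm hdM hH0.le x hr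
    have h3 : 4 * B / H ≤ ε / 8 := by
      rw [hH, div_div_eq_mul_div, div_le_div_iff₀ (by positivity) (by norm_num)]
      nlinarith
    have h4 : 1 / Real.log 2 ≤ 2 := by
      rw [div_le_iff₀ (by positivity)]
      linarith
    rw [e]
    refine (abs_add_le _ _).trans ?_
    rw [abs_mul, abs_of_pos (by positivity : 0 < 1 / Real.log 2)]
    have h5 := mul_le_mul h4 (h1.trans h3) (abs_nonneg _) zero_le_two
    linarith

theorem mainTheorem2 (f : ℝ → ℝ) (hf : f ∈ zygmundClass) (hfc : HasCompactSupport f) :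
    f ∈ zygmundClosure IBMO ↔
      ∀ ε : ℝ, 0 < ε → ∃ C : ℝ, 0 < C ∧
        ∀ a b : ℝ, a < b → zygmundDensity f ε a b ≤ ENNReal.ofReal C :=
  ⟨fun h _ hε => density_bound_of_mem_zygmundClosure h hε,
    mem_zygmundClosure_of_density_bound hf hfc⟩
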